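/- Let $\alpha_t,\alpha_e\ge 0$, $\alpha_s>0$, $\gamma_t,\gamma_s,\gamma_e>0$, and put $\alpha=\alpha_e+\alpha_s(\alpha_t-\tfrac12)$, $\nu_s=\alpha-1$. On $\mathbb R^2\times\mathbb R$ let $L=\gamma_s^2-\Delta$ act in space, let $\mathcal E_Q$ be centred Gaussian noise that is white in time and has precision operator $Q=\gamma_e^2L^{\alpha_e}$ in space (a centred Gaussian family indexed by Schwartz functions with $\mathrm{Cov}(\mathcal E_Q(\varphi),\mathcal E_Q(\psi))=\int\varphi\,Q^{-1}\psi$), and let $u$ be the solution (as a generalized random field on Schwartz functions) of $$\Bigl(\gamma_t\frac{\partial}{\partial t}+L^{\alpha_s/2}\Bigr)^{\alpha_t}u=\mathcal E_Q ,$$ where the operators are Fourier multipliers. Assume $\alpha>1$. Then $u$ has a space-time spectral density $S_u(\omega_s,\omega_t)$ whose marginal temporal spectrum $S_t(\omega_t)=\int_{\mathbb R^2}S_u(\omega_s,\omega_t)\,d\omega_s$ is, for some constant $C>0$ and all $\omega_t\in\mathbb R$, $$S_t(\omega_t)=C\;{}_2F_1\!\Bigl(\alpha_t,\ \tfrac{\alpha_e-1}{\alpha_s}+\alpha_t;\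 \tfrac{\alpha_e-1}{\alpha_s}+\alpha_t+1;\ -\gamma_t^2\gamma_s^{-2\alpha_s}\omega_t^2\Bigr),$$ where ${}_2F_1$ is Gauss' hypergeometric function, continued analytically to $\mathbb C\setminus[1,\infty)$. Moreover, if $u$ is given by a mean-square continuous random field $u(s,t)$ (square integrable at every point, with $u(\varphi)=\int\varphi(s,t)\,u(s,t)\,d(s,t)$ in $L^2$), then for every $s\in\mathbb R^2$ the process $t\mapsto u(s,t)$ has spectral density $S_t$, that is, $S_t$ is integrable and $\mathrm{Cov}(u(s,t_1),u(s,t_2))=\int_{\mathbb R}e^{i\omega(t_1-t_2)}S_t(\omega)\,d\omega$, and its mean-square smoothness is $$\nu_t=\min\Bigl[\alpha_t-\tfrac12,\ \frac{\nu_s}{\alpha_s}\Bigr]\ (\ge 0):$$ the process is $\nu$ times mean-square differentiable for every $0\le\nu<\nu_t$ and for no $\nu>\nu_t$. Here $\nu$ times mean-square differentiable means that the process, as a curve in $L^2$, is $\lfloor\nu\rfloor$ times continuously differentiable and its derivative of order $\lfloor\nu\rfloor$ is locally Hölder continuous with exponent $\nu-\lfloor\nu\rfloor$. -/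

import Mathlib

open MeasureTheory ProbabilityTheory
open scoped FourierTransform SchwartzMap ENNReal NNReal Topology

noncomputable section

namespace DEMF

/-- The spatial domain `ℝ²`, with its Euclidean norm. -/
abbrev Space : Type := EuclideanSpace ℝ (Fin 2)

/-- Space-time `ℝ² × ℝ` with its Euclidean inner product and Lebesgue measure:
`x.fst` is the spatial and `x.snd` the temporal coordinate. -/
abbrev SpaceTime : Type := WithLp 2 (Space × ℝ)

/-! ### Gauss' hypergeometric function -/

/-- `F` is the principal branch of `₂F₁(a, b; c; ·)`: it is holomorphic on `ℂ ∖ [1, ∞)` and is the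
sum of the Gauss series on the open unit disc. There is at most one such `F` on `ℂ ∖ [1, ∞)`. -/
def IsGaussHypergeometric (a b c : ℂ) (F : ℂ → ℂ) : Prop :=
  DifferentiableOn ℂ F {z | 1 - z ∈ Complex.slitPlane} ∧
    ∀ z : ℂ, ‖z‖ < 1 → F z = ordinaryHypergeometric a b c z

open Classical in
/-- Gauss' hypergeometric function `₂F₁(a, b; c; z)` for `z ∈ ℂ ∖ [1, ∞)`, the analytic
continuation of the hypergeometric series. (Mathlib's `ordinaryHypergeometric` is the sum of the
series, and so is meaningful on the unit disc only.) -/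
def gaussHypergeometric (a b c : ℂ) : ℂ → ℂ :=
  if h : ∃ F, IsGaussHypergeometric a b c F then h.choose else 0

/-! ### The equation -/

/-- The translation-invariant operator with symbol `m` (a function of the angular frequency `ω`),
applied to `φ`: it multiplies the Fourier transform of `φ` by `m`. Mathlib's Fourier transform uses
the frequency `ξ = ω / 2π`. The real part is taken only to land in `ℝ`: for the symbols used below,
`m (-ω)` is the conjugate of `m ω`, and the value is real. -/
def multiplierOp (m : SpaceTime → ℂ) (φ : SpaceTime → ℝ) : SpaceTime → ℝ := fun x =>
  (𝓕⁻ (fun ξ : SpaceTime =>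
    m ((2 * Real.pi) • ξ) * 𝓕 (fun y : SpaceTime => (φ y : ℂ)) ξ) x).re

/-- Symbol of `(γₜ ∂ₜ + L^(αₛ/2))^αₜ`, where `L = γₛ² - Δ` acts in space. The base of the outer
power has positive real part when `γₛ ≠ 0`, and the power is the principal one. -/
def evolutionSymbol (αt αs γt γs : ℝ) (ω : SpaceTime) : ℂ :=
  (Complex.I * (γt * ω.snd : ℝ) + ((γs ^ 2 + ‖ω.fst‖ ^ 2) ^ (αs / 2) : ℝ)) ^ (αt : ℂ)

/-- Symbol of the precision operator `Q = γₑ² L^αₑ`, where `L = γₛ² - Δ` acts in space. -/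
def precisionSymbol (αe γs γe : ℝ) (ω : SpaceTime) : ℝ :=
  γe ^ 2 * (γs ^ 2 + ‖ω.fst‖ ^ 2) ^ αe

variable {Ω : Type*} [MeasurableSpace Ω]

/-- `W` is Gaussian noise on `ℝ² × ℝ` that is white in time and has precision operator
`Q = γₑ² L^αₑ` in space: a centred Gaussian family indexed by test functions, with
`Cov(W φ, W ψ) = ∫ φ Q⁻¹ψ`. -/
structure IsNoise (αe γs γe : ℝ) (P : Measure Ω) (W : 𝓢(SpaceTime, ℝ) → Ω → ℝ) : Prop where
  gaussian : IsGaussianProcess W P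
  centred : ∀ φ, ∫ w, W φ w ∂P = 0
  covariance_eq : ∀ φ ψ : 𝓢(SpaceTime, ℝ), cov[W φ, W ψ; P] =
    ∫ x, φ x * multiplierOp (fun ω => ((precisionSymbol αe γs γe ω)⁻¹ : ℝ)) ψ x

/-- The generalized random field `u` solves `(γₜ ∂ₜ + L^(αₛ/2))^αₜ u = W` weakly: whenever the test
function `φ` is the transposed operator (with symbol `σ(-ω)`) applied to the test function `ψ`, then
`⟨u, φ⟩ = ⟨W, ψ⟩` almost surely. -/
def IsSolution (αt αs γt γs : ℝ) (P : Measure Ω) (W u : 𝓢(SpaceTime, ℝ) → Ω → ℝ) : Prop :=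
  ∀ φ ψ : 𝓢(SpaceTime, ℝ),
    (∀ x, φ x = multiplierOp (fun ω => evolutionSymbol αt αs γt γs (-ω)) ψ x) → u φ =ᵐ[P] W ψ

/-- The random field `U s t` is the pointwise, mean-square continuous version of the generalized
random field `u`: `⟨u, φ⟩ = ∫ φ(s, t) U(s, t) d(s, t)` for all test functions, as an integral of
functions with values in `L²(P)`. -/
structure IsPointwiseVersion (P : Measure Ω) (u : 𝓢(SpaceTime, ℝ) → Ω → ℝ)
    (U : Space → ℝ → Ω → ℝ) : Prop where
  memLp : ∀ s t, MemLp (U s t) 2 P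
  continuous : Continuous fun x : SpaceTime => (memLp x.fst x.snd).toLp (U x.fst x.snd)
  integrable : ∀ φ : 𝓢(SpaceTime, ℝ),
    Integrable fun x : SpaceTime => φ x • (memLp x.fst x.snd).toLp (U x.fst x.snd)
  eq_integral : ∀ φ : 𝓢(SpaceTime, ℝ), u φ =ᵐ[P]
    ((∫ x : SpaceTime, φ x • (memLp x.fst x.snd).toLp (U x.fst x.snd) : Lp ℝ 2 P) : Ω → ℝ)

/-! ### Spectra -/

/-- The Fourier transform `∫ φ(x) exp(-i⟨ω, x⟩) dx` at the angular frequency `ω`. -/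
def angularFourier (φ : SpaceTime → ℝ) (ω : SpaceTime) : ℂ :=
  𝓕 (fun y : SpaceTime => (φ y : ℂ)) ((2 * Real.pi)⁻¹ • ω)

/-- `S` is a spectral density (in angular frequency) of the generalized random field `u`, that is,
formally `Cov(u(x), u(y)) = ∫ exp(i⟨ω, x - y⟩) S(ω) dω`. -/
structure IsSpectrum (P : Measure Ω) (u : 𝓢(SpaceTime, ℝ) → Ω → ℝ) (S : SpaceTime → ℝ) :
    Prop where
  nonneg : ∀ ω, 0 ≤ S ω
  measurable : Measurable S
  memLp : ∀ φ, MemLp (u φ) 2 P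
  integrable : ∀ φ ψ : 𝓢(SpaceTime, ℝ), Integrable fun ω : SpaceTime =>
    (starRingEnd ℂ) (angularFourier φ ω) * angularFourier ψ ω * (S ω : ℂ)
  covariance_eq : ∀ φ ψ : 𝓢(SpaceTime, ℝ), ((cov[u φ, u ψ; P] : ℝ) : ℂ) =
    ∫ ω : SpaceTime, (starRingEnd ℂ) (angularFourier φ ω) * angularFourier ψ ω * (S ω : ℂ)

/-- `St` is the marginal temporal spectrum of `u`: the space-time spectral density of `u` with the
spatial frequency integrated out. -/
def IsMarginalTemporalSpectrum (P : Measure Ω) (u : 𝓢(SpaceTime, ℝ) → Ω → ℝ) (St : ℝ → ℝ) : Prop :=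
  ∃ S : SpaceTime → ℝ, IsSpectrum P u S ∧ ∀ ωt : ℝ,
    Integrable (fun ωs : Space => S (WithLp.toLp 2 (ωs, ωt))) ∧
      St ωt = ∫ ωs : Space, S (WithLp.toLp 2 (ωs, ωt))

/-- `S` is a spectral density of the real process `X`:
`Cov(X(t₁), X(t₂)) = ∫ exp(iω(t₁ - t₂)) S(ω) dω`. -/
structure IsProcessSpectrum (P : Measure Ω) (X : ℝ → Ω → ℝ) (S : ℝ → ℝ) : Prop where
  nonneg : ∀ ω, 0 ≤ S ω
  integrable : Integrable S
  covariance_eq : ∀ t₁ t₂ : ℝ, ((cov[X t₁, X t₂; P] : ℝ) : ℂ) =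
    ∫ ω : ℝ, Complex.exp (Complex.I * (ω * (t₁ - t₂) : ℝ)) * (S ω : ℂ)

/-! ### Mean-square smoothness -/

/-- The process `X` is `ν ≥ 0` times mean-square differentiable: as a curve in `L²(P)` it is `⌊ν⌋`
times continuously differentiable, with a derivative of order `⌊ν⌋` that is locally Hölder
continuous with exponent `ν - ⌊ν⌋` (no condition beyond continuity when `ν` is an integer). -/
def IsMSDifferentiable (P : Measure Ω) (X : ℝ → Ω → ℝ) (ν : ℝ) : Prop :=
  ∃ hX : ∀ t, MemLp (X t) 2 P,
    ContDiff ℝ (⌊ν⌋₊ : ℕ) (fun t => (hX t).toLp (X t)) ∧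
      ∀ t : ℝ, ∃ C : ℝ≥0, ∃ N ∈ 𝓝 t,
        HolderOnWith C (ν - ⌊ν⌋₊).toNNReal
          (iteratedDeriv ⌊ν⌋₊ fun r => (hX r).toLp (X r)) N

/-- The mean-square smoothness of `X` is `ν₀`: `X` is `ν` times mean-square differentiable for every
`0 ≤ ν < ν₀` and for no `ν > ν₀`. -/
def HasMSSmoothness (P : Measure Ω) (X : ℝ → Ω → ℝ) (ν₀ : ℝ) : Prop :=
  0 ≤ ν₀ ∧ (∀ ν : ℝ, 0 ≤ ν → ν < ν₀ → IsMSDifferentiable P X ν) ∧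
    ∀ ν : ℝ, ν₀ < ν → ¬ IsMSDifferentiable P X ν

end DEMF

end

noncomputable section

namespace DEMF

/-! ### Powers of functions of temperate growth -/

section TemperateGrowth

open scoped ContDiff

/-! The base of the evolution symbol stays in a right half plane away from 0. Hence its real powers,
negative ones included, are smooth, of temperate growth and Hermitian, and the transposed operator
maps real test functions onto real test functions. So `u φ` equals `W ψ` almost surely, where `ψ` is
the inverse operator applied to `φ`, and Plancherel turns the noise covariance into the space-time
density `(2π)⁻³ |σ|⁻² / Q`, with σ the evolution symbol (`IsSolution.isSpectrum`).

This density is radial in the spatial frequency. With `b = (αe - 1) / αs + αt`, polar coordinates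
and the substitution `w = (1 + |ωs|²/γs²)^(-αs)` convert its spatial integral into a multiple of
`∫₀¹ w^(b-1) (1 + κ ωt² w)^(-αt) dw`, where `κ = γt² γs^(-2αs)`. This is Euler's integral for
`₂F₁(αt, b; b + 1; -κ ωt²)` up to the factor `b` (`exists_marginalSpectrum_eq`,
`gaussHypergeometric_neg_ofReal`).

For a pointwise version, testing against mollifiers recovers the point values in `L²`. Fatou's lemma
makes the space-time density integrable, dominated convergence gives the covariance, and Fubini
leaves the temporal spectrum (`IsPointwiseVersion.isProcessSpectrum`).

Smoothness is read off from decay. Up to constants, Euler's integral is at least `x^(-min αt b)` for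
`x ≥ 1` and at most `x^(-p)` for every `0 ≤ p < min αt b`. The correspondence of `X t` with
`exp(iωt)` is isometric from `L²(P)` to `L²(S dω)`, so moments of the spectrum yield derivatives and
Hölder bounds (`contDiff_and_holderWith`). Conversely, frequencies of order `1/h` bound forward
differences of step `h` from below (`add_le_of_holderOnWith`). The threshold is `min αt b - 1/2`,
and `b - 1/2 = νs / αs`. -/

lemma isOpen_lt_re (δ : ℝ) : IsOpen {z : ℂ | δ < z.re} :=
  isOpen_lt continuous_const Complex.continuous_re

lemma mem_slitPlane_of_lt_re {δ : ℝ} (hδ : 0 < δ) {z : ℂ} (hz : δ < z.re) :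
    z ∈ Complex.slitPlane :=
  Or.inl (hδ.trans hz)

lemma norm_cpow_le_of_lt_re {δ : ℝ} (hδ : 0 < δ) (c : ℝ) :
    ∃ (k : ℕ) (C : ℝ), 0 ≤ C ∧ ∀ z : ℂ, δ < z.re → ‖z ^ (c : ℂ)‖ ≤ C * (1 + ‖z‖) ^ k := by
  have hpos : ∀ z : ℂ, δ < z.re → δ ≤ ‖z‖ := fun z hz =>
    hz.le.trans ((le_abs_self _).trans (Complex.abs_re_le_norm z))
  rcases le_total 0 c with hc | hc
  · refine ⟨⌈c⌉₊, 1, zero_le_one, fun z hz => ?_⟩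
    rw [Complex.norm_cpow_real, one_mul, ← Real.rpow_natCast]
    calc ‖z‖ ^ c ≤ (1 + ‖z‖) ^ c := by gcongr; linarith
      _ ≤ (1 + ‖z‖) ^ ((⌈c⌉₊ : ℕ) : ℝ) := by
        apply Real.rpow_le_rpow_of_exponent_le (by linarith [norm_nonneg z]) (Nat.le_ceil c)
  · refine ⟨0, δ ^ c, by positivity, fun z hz => ?_⟩
    rw [Complex.norm_cpow_real, pow_zero, mul_one]
    exact Real.rpow_le_rpow_of_nonpos hδ (hpos z hz) hc

/-- Differentiating `w ^ c` once gives `c * w ^ (c - 1)`, so the induction must treat all exponents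
together. Negative exponents are harmless because `‖w‖ > δ` on the half plane. -/
lemma norm_iteratedFDerivWithin_cpow_le {δ : ℝ} (hδ : 0 < δ) (n : ℕ) (c : ℝ) :
    ∃ (k : ℕ) (C : ℝ), 0 ≤ C ∧ ∀ z ∈ {z : ℂ | δ < z.re},
      ‖iteratedFDerivWithin ℝ n (fun w : ℂ => w ^ (c : ℂ)) {z | δ < z.re} z‖ ≤
        C * (1 + ‖z‖) ^ k := by
  induction n generalizing c with
  | zero => simpa using norm_cpow_le_of_lt_re hδ c
  | succ n ih =>
    obtain ⟨k, C, hC, h⟩ := ih (c - 1)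
    set t : Set ℂ := {z | δ < z.re}
    have ht : UniqueDiffOn ℝ t := (isOpen_lt_re δ).uniqueDiffOn
    -- A fixed real-linear map sending a complex number to multiplication by `c` times it; the
    -- derivative of `w ^ c` is `L` composed with `w ^ (c - 1)`.
    let L : ℂ →L[ℝ] ℂ →L[ℝ] ℂ := (c : ℂ) • ContinuousLinearMap.mul ℝ ℂ
    have hL : Set.EqOn (fderivWithin ℝ (fun w : ℂ => w ^ (c : ℂ)) t)
        (fun w => L (w ^ ((c - 1 : ℝ) : ℂ))) t := by
      intro z hz
      have hd : HasDerivAt (fun w : ℂ => w ^ (c : ℂ)) ((c : ℂ) * z ^ ((c : ℂ) - 1)) z := by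
        simpa using (hasDerivAt_id z).cpow_const (c := (c : ℂ)) (mem_slitPlane_of_lt_re hδ hz)
      have hf := (hd.hasFDerivAt.restrictScalars ℝ).hasFDerivWithinAt.fderivWithin
        (ht z hz)
      rw [hf]
      ext w
      all_goals simp [L]
      ring
    have hs : ContDiffOn ℝ n (fun w : ℂ => w ^ ((c - 1 : ℝ) : ℂ)) t := by
      intro z hz
      exact ((analyticAt_id (𝕜 := ℂ)).cpow analyticAt_const
        (mem_slitPlane_of_lt_re hδ hz)).contDiffAt.restrict_scalars ℝ |>.contDiffWithinAt
    refine ⟨k, ‖L‖ * C, by positivity, fun z hz => ?_⟩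
    have h1 : ‖iteratedFDerivWithin ℝ (n + 1) (fun w : ℂ => w ^ (c : ℂ)) t z‖ =
        ‖iteratedFDerivWithin ℝ n (fun w => L (w ^ ((c - 1 : ℝ) : ℂ))) t z‖ := by
      rw [← norm_iteratedFDerivWithin_fderivWithin ht hz,
        iteratedFDerivWithin_congr hL hz]
    rw [h1, mul_assoc]
    have h2 := L.iteratedFDerivWithin_comp_left (hs z hz) ht hz le_rfl
    rw [Function.comp_def] at h2
    rw [h2]
    refine (ContinuousLinearMap.norm_compContinuousMultilinearMap_le _ _).trans ?_
    gcongr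
    exact h z hz

variable {E : Type*} [NormedAddCommGroup E] [NormedSpace ℝ E]

/-- A real power of a function of temperate growth with values in a right half plane
`{z | δ < re z}`, `δ > 0`, has temperate growth. -/
theorem hasTemperateGrowth_cpow {f : E → ℂ} (hf : f.HasTemperateGrowth) {δ : ℝ} (hδ : 0 < δ)
    (hfδ : ∀ x, δ < (f x).re) (c : ℝ) : (fun x => f x ^ (c : ℂ)).HasTemperateGrowth := by
  refine Function.HasTemperateGrowth.comp' (g := fun w : ℂ => w ^ (c : ℂ))
    (t := {z | δ < z.re}) ?_ (isOpen_lt_re δ).uniqueDiffOn ?_ ?_ hf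
  · rintro _ ⟨x, rfl⟩
    exact hfδ x
  · intro z hz
    exact ((analyticAt_id (𝕜 := ℂ)).cpow analyticAt_const
      (mem_slitPlane_of_lt_re hδ hz)).contDiffAt.restrict_scalars ℝ |>.contDiffWithinAt
  · intro N
    choose k C hC h using fun n => norm_iteratedFDerivWithin_cpow_le hδ n c
    refine ⟨(Finset.range (N + 1)).sup k, ∑ n ∈ Finset.range (N + 1), C n,
      Finset.sum_nonneg fun n _ => hC n, fun n hn z hz => (h n z hz).trans ?_⟩
    have hn' : n ∈ Finset.range (N + 1) := by simpa using Nat.lt_succ_of_le hn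
    gcongr
    · exact Finset.sum_nonneg fun n _ => hC n
    · exact Finset.single_le_sum (f := C) (fun n _ => hC n) hn'
    · linarith [norm_nonneg z]
    · exact Finset.le_sup hn'

end TemperateGrowth

/-! ### The symbols -/

section Symbols

/-- The symbol of `L = γₛ² - Δ`. -/
def helmholtzSymbol (γs : ℝ) (ω : SpaceTime) : ℝ := γs ^ 2 + ‖ω.fst‖ ^ 2

lemma sq_le_helmholtzSymbol (γs : ℝ) (ω : SpaceTime) : γs ^ 2 ≤ helmholtzSymbol γs ω :=
  le_add_of_nonneg_right (by positivity)

lemma helmholtzSymbol_pos {γs : ℝ} (hγs : 0 < γs) (ω : SpaceTime) : 0 < helmholtzSymbol γs ω :=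
  lt_of_lt_of_le (by positivity) (sq_le_helmholtzSymbol γs ω)

lemma helmholtzSymbol_neg (γs : ℝ) (ω : SpaceTime) :
    helmholtzSymbol γs (-ω) = helmholtzSymbol γs ω := by
  simp [helmholtzSymbol]

lemma helmholtzSymbol_rpow_hasTemperateGrowth {γs : ℝ} (hγs : 0 < γs) (r : ℝ) :
    (fun ω => ((helmholtzSymbol γs ω ^ r : ℝ) : ℂ)).HasTemperateGrowth := by
  have h1 : (fun ω : SpaceTime => ((helmholtzSymbol γs ω : ℝ) : ℂ)).HasTemperateGrowth := by
    have h2 : (fun ω : SpaceTime => ‖ω.fst‖ ^ 2).HasTemperateGrowth :=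
      (Function.hasTemperateGrowth_norm_sq Space).comp
        (WithLp.fstL 2 ℝ Space ℝ).hasTemperateGrowth
    exact Function.Complex.hasTemperateGrowth_ofReal.comp
      ((Function.HasTemperateGrowth.const (γs ^ 2)).add h2)
  -- The half plane is open, so `δ` has to lie strictly below the minimum `γs ^ 2` of the symbol.
  have h3 := hasTemperateGrowth_cpow h1 (δ := γs ^ 2 / 2) (by positivity) (fun ω => by
    have := sq_le_helmholtzSymbol γs ω
    have : 0 < γs ^ 2 := by positivity
    rw [Complex.ofReal_re]
    linarith) r
  convert h3 using 2 with ω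
  rw [Complex.ofReal_cpow (helmholtzSymbol_pos hγs ω).le]

/-- The symbol of `γₜ ∂ₜ + L^(αₛ/2)`. -/
def heatSymbol (αs γt γs : ℝ) (ω : SpaceTime) : ℂ :=
  Complex.I * (γt * ω.snd : ℝ) + ((γs ^ 2 + ‖ω.fst‖ ^ 2) ^ (αs / 2) : ℝ)

lemma heatSymbol_re (αs γt γs : ℝ) (ω : SpaceTime) :
    (heatSymbol αs γt γs ω).re = helmholtzSymbol γs ω ^ (αs / 2) := by
  simp only [heatSymbol, Complex.add_re, Complex.mul_re, Complex.I_re, Complex.I_im,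
    Complex.ofReal_re, Complex.ofReal_im, helmholtzSymbol]
  ring

lemma heatSymbol_im (αs γt γs : ℝ) (ω : SpaceTime) :
    (heatSymbol αs γt γs ω).im = γt * ω.snd := by
  simp only [heatSymbol, Complex.add_im, Complex.mul_im, Complex.I_re, Complex.I_im,
    Complex.ofReal_re, Complex.ofReal_im]
  ring

lemma le_heatSymbol_re {αs γs : ℝ} (hαs : 0 < αs) (hγs : 0 < γs) (γt : ℝ) (ω : SpaceTime) :
    (γs ^ 2) ^ (αs / 2) ≤ (heatSymbol αs γt γs ω).re := by
  rw [heatSymbol_re]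
  exact Real.rpow_le_rpow (by positivity) (sq_le_helmholtzSymbol γs ω) (by positivity)

lemma heatSymbol_re_pos {αs γs : ℝ} (hαs : 0 < αs) (hγs : 0 < γs) (γt : ℝ) (ω : SpaceTime) :
    0 < (heatSymbol αs γt γs ω).re :=
  lt_of_lt_of_le (by positivity) (le_heatSymbol_re hαs hγs γt ω)

lemma heatSymbol_ne_zero {αs γs : ℝ} (hαs : 0 < αs) (hγs : 0 < γs) (γt : ℝ) (ω : SpaceTime) :
    heatSymbol αs γt γs ω ≠ 0 := fun h => by
  have := heatSymbol_re_pos hαs hγs γt ω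
  simp [h] at this

lemma conj_heatSymbol (αs γt γs : ℝ) (ω : SpaceTime) :
    (starRingEnd ℂ) (heatSymbol αs γt γs ω) = heatSymbol αs γt γs (-ω) := by
  apply Complex.ext
  · simp [heatSymbol_re, helmholtzSymbol_neg]
  · simp [heatSymbol_im]

lemma heatSymbol_cpow_hasTemperateGrowth {αs γs : ℝ} (hαs : 0 < αs) (hγs : 0 < γs) (γt c : ℝ) :
    (fun ω => heatSymbol αs γt γs ω ^ (c : ℂ)).HasTemperateGrowth := by
  have h1 : (fun ω : SpaceTime => Complex.I * ((γt * ω.snd : ℝ) : ℂ)).HasTemperateGrowth := by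
    refine (Function.HasTemperateGrowth.const Complex.I).mul
      (Function.Complex.hasTemperateGrowth_ofReal.comp ?_)
    exact (Function.HasTemperateGrowth.const γt).mul
      (WithLp.sndL 2 ℝ Space ℝ).hasTemperateGrowth
  have h2 := h1.add (helmholtzSymbol_rpow_hasTemperateGrowth hγs (αs / 2))
  have hpos : 0 < (γs ^ 2) ^ (αs / 2) := by positivity
  exact hasTemperateGrowth_cpow h2 (δ := (γs ^ 2) ^ (αs / 2) / 2) (by positivity)
    (fun ω => by
      have := le_heatSymbol_re hαs hγs γt ω
      change _ < (heatSymbol αs γt γs ω).re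
      linarith) c

/-- The principal power commutes with conjugation off the negative real axis. This Hermitian
symmetry is what keeps the multipliers real. -/
lemma conj_heatSymbol_cpow {αs γs : ℝ} (hαs : 0 < αs) (hγs : 0 < γs) (γt c : ℝ) (ω : SpaceTime) :
    (starRingEnd ℂ) (heatSymbol αs γt γs ω ^ (c : ℂ)) = heatSymbol αs γt γs (-ω) ^ (c : ℂ) := by
  have harg : (heatSymbol αs γt γs ω).arg ≠ Real.pi :=
    (Complex.mem_slitPlane_iff_arg.1 (Or.inl (heatSymbol_re_pos hαs hγs γt ω))).1
  rw [← conj_heatSymbol, Complex.conj_cpow _ _ harg, Complex.conj_ofReal]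

end Symbols

/-! ### Fourier multipliers on real test functions -/

section Multipliers

/-- A real test function, as a complex valued one. -/
def complexify (φ : 𝓢(SpaceTime, ℝ)) : 𝓢(SpaceTime, ℂ) := φ.postcompCLM Complex.ofRealCLM

lemma complexify_coe (φ : 𝓢(SpaceTime, ℝ)) : ⇑(complexify φ) = fun y => (φ y : ℂ) := rfl

lemma fourier_complexify (φ : 𝓢(SpaceTime, ℝ)) (ξ : SpaceTime) :
    𝓕 (complexify φ) ξ = 𝓕 (fun y => (φ y : ℂ)) ξ := by
  rw [SchwartzMap.fourier_coe, complexify_coe]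

lemma fourier_ofReal_neg (φ : SpaceTime → ℝ) (ξ : SpaceTime) :
    𝓕 (fun y => (φ y : ℂ)) (-ξ) = (starRingEnd ℂ) (𝓕 (fun y => (φ y : ℂ)) ξ) := by
  simp only [Real.fourier_eq, Circle.smul_def]
  rw [← integral_conj]
  congr 1 with v
  simp [Circle.starRingEnd_addChar]

lemma conj_fourierInv_of_hermitian {g : SpaceTime → ℂ}
    (hg : ∀ ξ, g (-ξ) = (starRingEnd ℂ) (g ξ)) (x : SpaceTime) :
    (starRingEnd ℂ) (𝓕⁻ g x) = 𝓕⁻ g x := by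
  simp only [Real.fourierInv_eq, Circle.smul_def]
  rw [← integral_conj, ← integral_neg_eq_self]
  congr 1 with v
  simp [Circle.starRingEnd_addChar, hg]

/-- The operator with a Hermitian symbol of temperate growth maps real test functions to real test
functions. -/
theorem exists_schwartz_eq_multiplierOp {m : SpaceTime → ℂ} (hm : m.HasTemperateGrowth)
    (hsymm : ∀ ω, m (-ω) = (starRingEnd ℂ) (m ω)) (φ : 𝓢(SpaceTime, ℝ)) :
    ∃ ψ : 𝓢(SpaceTime, ℝ), (∀ x, ψ x = multiplierOp m φ x) ∧
      ∀ ξ, 𝓕 (complexify ψ) ξ = m ((2 * Real.pi) • ξ) * 𝓕 (complexify φ) ξ := by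
  set m' : SpaceTime → ℂ := fun ξ => m ((2 * Real.pi) • ξ) with hm'
  have hm't : m'.HasTemperateGrowth :=
    hm.comp ((2 * Real.pi) • ContinuousLinearMap.id ℝ SpaceTime).hasTemperateGrowth
  set χ : 𝓢(SpaceTime, ℂ) := SchwartzMap.smulLeftCLM ℂ m' (𝓕 (complexify φ))
  have hχ : ∀ ξ, χ ξ = m ((2 * Real.pi) • ξ) * 𝓕 (complexify φ) ξ := fun ξ => by
    exact SchwartzMap.smulLeftCLM_apply_apply hm't _ ξ
  have hinv : ∀ x, 𝓕⁻ χ x = 𝓕⁻ (fun ξ : SpaceTime => m ((2 * Real.pi) • ξ) *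
      𝓕 (fun y : SpaceTime => (φ y : ℂ)) ξ) x := fun x => by
    rw [SchwartzMap.fourierInv_coe]
    refine congrArg (fun g : SpaceTime → ℂ => 𝓕⁻ g x) (funext fun ξ => ?_)
    rw [hχ, fourier_complexify]
  have hreal : ∀ x, (((𝓕⁻ χ x).re : ℝ) : ℂ) = 𝓕⁻ χ x := fun x => by
    rw [← Complex.conj_eq_iff_re, SchwartzMap.fourierInv_coe]
    refine conj_fourierInv_of_hermitian (fun ξ => ?_) x
    rw [hχ, hχ, fourier_complexify, fourier_complexify, fourier_ofReal_neg, smul_neg, hsymm,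
      map_mul]
  refine ⟨(𝓕⁻ χ).postcompCLM Complex.reCLM, fun x => ?_, fun ξ => ?_⟩
  · simp only [SchwartzMap.postcompCLM_apply, Complex.reCLM_apply, multiplierOp, hinv]
  · have : complexify ((𝓕⁻ χ).postcompCLM Complex.reCLM) = 𝓕⁻ χ := by
      ext x
      simp only [complexify, SchwartzMap.postcompCLM_apply, Complex.reCLM_apply,
        Complex.ofRealCLM_apply, hreal]
    rw [this, FourierTransform.fourier_fourierInv_eq, hχ]

lemma multiplierOp_eq_of_fourier_eq {m : SpaceTime → ℂ} {φ ψ : 𝓢(SpaceTime, ℝ)}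
    (h : ∀ ξ, m ((2 * Real.pi) • ξ) * 𝓕 (complexify ψ) ξ = 𝓕 (complexify φ) ξ) (x : SpaceTime) :
    φ x = multiplierOp m ψ x := by
  have h1 : (fun ξ : SpaceTime => m ((2 * Real.pi) • ξ) *
      𝓕 (fun y : SpaceTime => (ψ y : ℂ)) ξ) = ⇑(𝓕 (complexify φ) : 𝓢(SpaceTime, ℂ)) := by
    ext ξ
    rw [← h, fourier_complexify]
  rw [multiplierOp, h1, ← SchwartzMap.fourierInv_coe, FourierTransform.fourierInv_fourier_eq]
  simp [complexify]

/-- Plancherel's identity, applied to real functions viewed as complex ones. -/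
lemma integral_mul_eq_integral_fourier (φ ψ : 𝓢(SpaceTime, ℝ)) :
    ((∫ x, φ x * ψ x : ℝ) : ℂ) =
      ∫ ξ, (starRingEnd ℂ) (𝓕 (complexify φ) ξ) * 𝓕 (complexify ψ) ξ := by
  have h := SchwartzMap.integral_inner_fourier_fourier (complexify φ) (complexify ψ)
  simp only [RCLike.inner_apply'] at h
  rw [h, ← integral_complex_ofReal]
  simp [complexify]

lemma angularFourier_smul (φ : 𝓢(SpaceTime, ℝ)) (ξ : SpaceTime) :
    angularFourier φ ((2 * Real.pi) • ξ) = 𝓕 (complexify φ) ξ := by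
  rw [angularFourier, smul_smul, inv_mul_cancel₀ (by positivity), one_smul, fourier_complexify]

lemma finrank_spaceTime : Module.finrank ℝ SpaceTime = 3 := by
  have h : Module.finrank ℝ SpaceTime = Module.finrank ℝ (Space × ℝ) :=
    (WithLp.linearEquiv 2 ℝ (Space × ℝ)).finrank_eq
  simp [h]

end Multipliers

lemma covariance_congr_ae {Ω : Type*} [MeasurableSpace Ω] {P : Measure Ω} {X X' Y Y' : Ω → ℝ}
    (hX : X =ᵐ[P] X') (hY : Y =ᵐ[P] Y') : cov[X, Y; P] = cov[X', Y'; P] := by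
  rw [covariance, covariance, integral_congr_ae hX, integral_congr_ae hY]
  refine integral_congr_ae ?_
  filter_upwards [hX, hY] with w h1 h2
  rw [h1, h2]

/-! ### The space-time spectrum of the solution -/

section FieldSpectrum

variable {αt αs αe γt γs γe : ℝ}

/-- The space-time spectral density of the solution. -/
def fieldSpectrum (αt αs αe γt γs γe : ℝ) (ω : SpaceTime) : ℝ :=
  ((2 * Real.pi) ^ 3)⁻¹ * (γe ^ 2)⁻¹ *
    ((γt ^ 2 * ω.snd ^ 2 + helmholtzSymbol γs ω ^ αs) ^ (-αt) * helmholtzSymbol γs ω ^ (-αe))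

lemma normSq_heatSymbol (hγs : 0 < γs) (ω : SpaceTime) :
    ‖heatSymbol αs γt γs ω‖ ^ 2 = γt ^ 2 * ω.snd ^ 2 + helmholtzSymbol γs ω ^ αs := by
  rw [← Complex.normSq_eq_norm_sq, Complex.normSq_apply, heatSymbol_re, heatSymbol_im,
    ← Real.rpow_add (helmholtzSymbol_pos hγs ω)]
  ring_nf

/-- The density is `|σ|⁻²` times the symbol of `Q⁻¹`; `(2π)⁻³` is the Jacobian between ordinary and
angular frequency on a three-dimensional space. -/
lemma fieldSpectrum_eq (hγs : 0 < γs) (ω : SpaceTime) :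
    fieldSpectrum αt αs αe γt γs γe ω =
      ((2 * Real.pi) ^ 3)⁻¹ * (‖heatSymbol αs γt γs ω ^ ((-αt : ℝ) : ℂ)‖ ^ 2 *
        (precisionSymbol αe γs γe ω)⁻¹) := by
  have h1 : ‖heatSymbol αs γt γs ω ^ ((-αt : ℝ) : ℂ)‖ ^ 2 =
      (γt ^ 2 * ω.snd ^ 2 + helmholtzSymbol γs ω ^ αs) ^ (-αt) := by
    rw [Complex.norm_cpow_real, ← normSq_heatSymbol hγs, ← Real.rpow_natCast, ← Real.rpow_natCast,
      ← Real.rpow_mul (norm_nonneg _), ← Real.rpow_mul (norm_nonneg _), mul_comm]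
  rw [h1, fieldSpectrum, precisionSymbol, mul_inv]
  change _ = _ * (_ * (_ * (helmholtzSymbol γs ω ^ αe)⁻¹))
  rw [← Real.rpow_neg (helmholtzSymbol_pos hγs ω).le]
  ring

lemma fieldSpectrum_nonneg (hγs : 0 < γs) (ω : SpaceTime) :
    0 ≤ fieldSpectrum αt αs αe γt γs γe ω := by
  have := (helmholtzSymbol_pos hγs ω).le
  unfold fieldSpectrum
  positivity

lemma continuous_helmholtzSymbol (γs : ℝ) : Continuous (helmholtzSymbol γs) := by
  unfold helmholtzSymbol
  exact continuous_const.add (((WithLp.fstL 2 ℝ Space ℝ).continuous.norm).pow 2)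

lemma continuous_fieldSpectrum (hγs : 0 < γs) :
    Continuous (fieldSpectrum αt αs αe γt γs γe) := by
  have h1 := continuous_helmholtzSymbol γs
  have h2 : Continuous fun ω : SpaceTime => ω.snd := (WithLp.sndL 2 ℝ Space ℝ).continuous
  refine continuous_const.mul (Continuous.mul ?_ ?_)
  · refine Continuous.rpow_const ?_ fun ω => Or.inl ?_
    · exact (continuous_const.mul (h2.pow 2)).add
        (h1.rpow_const fun ω => Or.inl (helmholtzSymbol_pos hγs ω).ne')
    · have := Real.rpow_pos_of_pos (helmholtzSymbol_pos hγs ω) αs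
      positivity
  · exact h1.rpow_const fun ω => Or.inl (helmholtzSymbol_pos hγs ω).ne'

lemma precisionSymbol_inv_hasTemperateGrowth (αe : ℝ) (hγs : 0 < γs) (γe : ℝ) :
    (fun ω => (((precisionSymbol αe γs γe ω)⁻¹ : ℝ) : ℂ)).HasTemperateGrowth := by
  have h := (Function.HasTemperateGrowth.const (((γe ^ 2)⁻¹ : ℝ) : ℂ)).mul
    (helmholtzSymbol_rpow_hasTemperateGrowth hγs (-αe))
  refine (congrArg Function.HasTemperateGrowth ?_).mpr h
  ext ω
  rw [Pi.mul_apply, ← Complex.ofReal_mul, Real.rpow_neg (helmholtzSymbol_pos hγs ω).le, ← mul_inv]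
  rfl

/-- Every test function is the image of a test function under the transposed operator. -/
lemma exists_transposed_preimage (hαs : 0 < αs) (hγs : 0 < γs) (αt γt : ℝ)
    (φ : 𝓢(SpaceTime, ℝ)) :
    ∃ ψ : 𝓢(SpaceTime, ℝ),
      (∀ x, φ x = multiplierOp (fun ω => evolutionSymbol αt αs γt γs (-ω)) ψ x) ∧
      ∀ ξ, 𝓕 (complexify ψ) ξ =
        heatSymbol αs γt γs (-((2 * Real.pi) • ξ)) ^ ((-αt : ℝ) : ℂ) * 𝓕 (complexify φ) ξ := by
  have hm := (heatSymbol_cpow_hasTemperateGrowth hαs hγs γt (-αt)).comp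
    (-ContinuousLinearMap.id ℝ SpaceTime).hasTemperateGrowth
  obtain ⟨ψ, -, hψ⟩ := exists_schwartz_eq_multiplierOp
    (m := fun ω => heatSymbol αs γt γs (-ω) ^ ((-αt : ℝ) : ℂ)) hm
    (fun ω => (conj_heatSymbol_cpow hαs hγs γt (-αt) (-ω)).symm) φ
  refine ⟨ψ, multiplierOp_eq_of_fourier_eq fun ξ => ?_, hψ⟩
  rw [hψ, ← mul_assoc]
  change heatSymbol αs γt γs _ ^ (αt : ℂ) * _ * _ = _
  rw [← Complex.cpow_add _ _ (heatSymbol_ne_zero hαs hγs γt _)]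
  simp

variable {Ω : Type*} [MeasurableSpace Ω] {P : Measure Ω} {W u : 𝓢(SpaceTime, ℝ) → Ω → ℝ}

lemma IsSolution.exists_ae_eq_noise (hαs : 0 < αs) (hγs : 0 < γs)
    (hu : IsSolution αt αs γt γs P W u) (φ : 𝓢(SpaceTime, ℝ)) :
    ∃ ψ, u φ =ᵐ[P] W ψ :=
  let ⟨ψ, hψ, _⟩ := exists_transposed_preimage hαs hγs αt γt φ
  ⟨ψ, hu φ ψ hψ⟩

lemma IsNoise.memLp (hW : IsNoise αe γs γe P W) (φ : 𝓢(SpaceTime, ℝ)) : MemLp (W φ) 2 P :=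
  (hW.gaussian.hasGaussianLaw_eval φ).memLp_two

lemma IsSolution.integral_eq_zero (hαs : 0 < αs) (hγs : 0 < γs) (hW : IsNoise αe γs γe P W)
    (hu : IsSolution αt αs γt γs P W u) (φ : 𝓢(SpaceTime, ℝ)) : ∫ w, u φ w ∂P = 0 := by
  obtain ⟨ψ, hψ⟩ := hu.exists_ae_eq_noise hαs hγs φ
  rw [integral_congr_ae hψ, hW.centred]

/-- Inverting the transposed operator reduces covariances of `u` to those of the noise, which
Plancherel evaluates. The resulting integrand is a product of Schwartz functions, so its
integrability comes for free. -/
theorem IsSolution.isSpectrum (hαs : 0 < αs) (hγs : 0 < γs) (hW : IsNoise αe γs γe P W)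
    (hu : IsSolution αt αs γt γs P W u) :
    IsSpectrum P u (fieldSpectrum αt αs αe γt γs γe) := by
  have key : ∀ φ₁ φ₂ : 𝓢(SpaceTime, ℝ), ∃ ψ₁ χ : 𝓢(SpaceTime, ℝ),
      ((cov[u φ₁, u φ₂; P] : ℝ) : ℂ) =
        ∫ ξ, (starRingEnd ℂ) (𝓕 (complexify ψ₁) ξ) * 𝓕 (complexify χ) ξ ∧
      ∀ ξ : SpaceTime, (starRingEnd ℂ) (𝓕 (complexify ψ₁) ξ) * 𝓕 (complexify χ) ξ =
        ((2 * Real.pi) ^ 3 : ℝ) • ((starRingEnd ℂ) (angularFourier φ₁ ((2 * Real.pi) • ξ)) *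
          angularFourier φ₂ ((2 * Real.pi) • ξ) *
          (fieldSpectrum αt αs αe γt γs γe ((2 * Real.pi) • ξ) : ℂ)) := by
    intro φ₁ φ₂
    obtain ⟨ψ₁, hφ₁, hψ₁⟩ := exists_transposed_preimage hαs hγs αt γt φ₁
    obtain ⟨ψ₂, hφ₂, hψ₂⟩ := exists_transposed_preimage hαs hγs αt γt φ₂
    obtain ⟨χ, hχ, hχ'⟩ := exists_schwartz_eq_multiplierOp
      (precisionSymbol_inv_hasTemperateGrowth αe hγs γe)
      (fun ω => by simp [precisionSymbol]) ψ₂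
    refine ⟨ψ₁, χ, ?_, fun ξ => ?_⟩
    · rw [covariance_congr_ae (hu φ₁ ψ₁ hφ₁) (hu φ₂ ψ₂ hφ₂), hW.covariance_eq,
        ← integral_mul_eq_integral_fourier]
      simp_rw [hχ]
    · rw [hψ₁, hχ', hψ₂, angularFourier_smul, angularFourier_smul, fieldSpectrum_eq hγs,
        map_mul, conj_heatSymbol_cpow hαs hγs, neg_neg]
      set ω := (2 * Real.pi) • ξ
      set z := heatSymbol αs γt γs ω ^ ((-αt : ℝ) : ℂ) with hz
      have h1 : heatSymbol αs γt γs (-ω) ^ ((-αt : ℝ) : ℂ) = (starRingEnd ℂ) z :=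
        (conj_heatSymbol_cpow hαs hγs γt (-αt) ω).symm
      -- The transposed symbol at `ω` contributes `conj z`, and the conjugated Fourier transform
      -- contributes `z`; together they give `|z|²`.
      have h2 : ((‖z‖ ^ 2 : ℝ) : ℂ) = z * (starRingEnd ℂ) z := by
        rw [Complex.mul_conj, Complex.normSq_eq_norm_sq]
      have h3 : ((2 * Real.pi : ℝ) : ℂ) ^ 3 ≠ 0 := by
        simp [Real.pi_ne_zero]
      rw [h1, Complex.real_smul, Complex.ofReal_mul, Complex.ofReal_mul (‖z‖ ^ 2), h2,
        Complex.ofReal_inv ((2 * Real.pi) ^ 3), Complex.ofReal_pow]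
      field_simp
  have hpi : (2 * Real.pi : ℝ) ≠ 0 := by positivity
  refine ⟨fieldSpectrum_nonneg hγs, (continuous_fieldSpectrum hγs).measurable, fun φ => ?_,
    fun φ₁ φ₂ => ?_, fun φ₁ φ₂ => ?_⟩
  · obtain ⟨ψ, hψ⟩ := hu.exists_ae_eq_noise hαs hγs φ
    exact (memLp_congr_ae hψ).2 (hW.memLp ψ)
  · obtain ⟨ψ, χ, -, h⟩ := key φ₁ φ₂
    rw [← integrable_comp_smul_iff volume _ hpi]
    have hint : Integrable fun ξ => (starRingEnd ℂ) (𝓕 (complexify ψ) ξ) *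
        𝓕 (complexify χ) ξ := by
      have h1 := ((𝓕 (complexify χ)).integrable (μ := volume)).bdd_mul
        (c := ‖(𝓕 (complexify ψ)).toBoundedContinuousFunction‖)
        (f := fun ξ => (starRingEnd ℂ) (𝓕 (complexify ψ) ξ))
        (Complex.continuous_conj.comp (𝓕 (complexify ψ)).continuous).aestronglyMeasurable
        (Filter.Eventually.of_forall fun ξ => by
          rw [RCLike.norm_conj]
          exact (𝓕 (complexify ψ)).toBoundedContinuousFunction.norm_coe_le_norm ξ)
      exact h1
    simp_rw [h] at hint
    exact (integrable_smul_iff (c := (2 * Real.pi) ^ 3) (by positivity) _).1 hint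
  · obtain ⟨ψ, χ, hcov, h⟩ := key φ₁ φ₂
    rw [hcov]
    simp_rw [h]
    rw [integral_smul, Measure.integral_comp_smul volume (fun ω => (starRingEnd ℂ)
      (angularFourier φ₁ ω) * angularFourier φ₂ ω *
      (fieldSpectrum αt αs αe γt γs γe ω : ℂ)), finrank_spaceTime, smul_smul,
      abs_of_nonneg (by positivity), mul_inv_cancel₀ (by positivity), one_smul]

end FieldSpectrum

/-! ### Euler's integral for `₂F₁(a, b; b + 1; ·)` -/

section Hypergeometric

open Set

lemma integrableOn_Ioo_rpow {r : ℝ} (hr : -1 < r) :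
    IntegrableOn (fun w : ℝ => w ^ r) (Ioo 0 1) :=
  (intervalIntegral.integrableOn_Ioo_rpow_iff one_pos).2 hr

lemma setIntegral_Ioo_rpow {r : ℝ} (hr : -1 < r) : ∫ w in Ioo (0 : ℝ) 1, w ^ r = (r + 1)⁻¹ := by
  rw [← integral_Ioc_eq_integral_Ioo, ← intervalIntegral.integral_of_le zero_le_one,
    integral_rpow (Or.inl hr), Real.one_rpow, Real.zero_rpow (by linarith)]
  simp

/-- The slit plane is star-shaped about 1, and `1 - z * w` lies on the segment from 1 to `1 - z`. -/
lemma one_sub_mul_mem_slitPlane {z : ℂ} (hz : 1 - z ∈ Complex.slitPlane) {w : ℝ}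
    (hw : w ∈ Icc (0 : ℝ) 1) : 1 - z * w ∈ Complex.slitPlane := by
  have := Complex.starConvex_one_slitPlane.add_smul_mem (y := -z)
    (by simpa [sub_eq_add_neg] using hz) hw.1 hw.2
  convert this using 1
  rw [Complex.real_smul]
  ring

lemma isOpen_one_sub_mem_slitPlane : IsOpen {z : ℂ | 1 - z ∈ Complex.slitPlane} :=
  Complex.isOpen_slitPlane.preimage (by fun_prop : Continuous fun z : ℂ => 1 - z)

lemma isPreconnected_one_sub_mem_slitPlane :
    IsPreconnected {z : ℂ | 1 - z ∈ Complex.slitPlane} := by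
  have h : StarConvex ℝ (0 : ℂ) {z : ℂ | 1 - z ∈ Complex.slitPlane} := by
    rw [starConvex_zero_iff]
    intro z hz t ht0 ht1
    have := one_sub_mul_mem_slitPlane hz ⟨ht0, ht1⟩
    simpa [mul_comm] using this
  exact (h.isPathConnected (by simp)).isConnected.isPreconnected

/-- Euler's integral representation of `₂F₁(a, b; b + 1; z)`. -/
def eulerIntegral (a b : ℝ) (z : ℂ) : ℂ :=
  b * ∫ w in Ioo (0 : ℝ) 1, ((w ^ (b - 1) : ℝ) : ℂ) * (1 - z * w) ^ ((-a : ℝ) : ℂ)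

lemma continuousOn_one_sub_mul_cpow (c : ℂ) :
    ContinuousOn (fun p : ℂ × ℝ => (1 - p.1 * p.2) ^ c)
      ({z : ℂ | 1 - z ∈ Complex.slitPlane} ×ˢ Icc (0 : ℝ) 1) := by
  refine ContinuousOn.cpow_const ?_ fun p hp => one_sub_mul_mem_slitPlane hp.1 hp.2
  fun_prop

lemma aestronglyMeasurable_eulerIntegrand {z : ℂ} (hz : 1 - z ∈ Complex.slitPlane)
    (r : ℝ) (c : ℂ) :
    AEStronglyMeasurable (fun w : ℝ => ((w ^ r : ℝ) : ℂ) * (1 - z * w) ^ c)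
      (volume.restrict (Ioo 0 1)) := by
  refine (Complex.measurable_ofReal.comp
    (measurable_id.pow_const r)).aestronglyMeasurable.mul ?_
  refine ContinuousOn.aestronglyMeasurable ?_ measurableSet_Ioo
  exact (continuousOn_one_sub_mul_cpow c).comp (f := fun w : ℝ => (z, w))
    (by fun_prop) fun w hw => ⟨hz, Ioo_subset_Icc_self hw⟩

/-- Differentiation under the integral sign: near `z₀` the powers of `1 - z * w` are bounded by
compactness, uniformly in `w ∈ [0, 1]`, while the weight `w ^ (b - 1)` is integrable because `b >
0`. -/
lemma differentiableOn_eulerIntegral (a : ℝ) {b : ℝ} (hb : 0 < b) :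
    DifferentiableOn ℂ (eulerIntegral a b) {z | 1 - z ∈ Complex.slitPlane} := by
  intro z₀ hz₀
  refine DifferentiableAt.differentiableWithinAt (DifferentiableAt.const_mul ?_ _)
  obtain ⟨ε, hε, hball⟩ := Metric.nhds_basis_closedBall.mem_iff.1
    (isOpen_one_sub_mem_slitPlane.mem_nhds hz₀)
  have hK : IsCompact (Metric.closedBall z₀ ε ×ˢ Icc (0 : ℝ) 1) :=
    (isCompact_closedBall z₀ ε).prod isCompact_Icc
  obtain ⟨M, hM⟩ := hK.exists_bound_of_continuousOn
    ((continuousOn_one_sub_mul_cpow ((-a : ℝ) : ℂ)).mono (prod_mono hball subset_rfl))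
  obtain ⟨M', hM'⟩ := hK.exists_bound_of_continuousOn
    ((continuousOn_one_sub_mul_cpow (((-a : ℝ) : ℂ) - 1)).mono (prod_mono hball subset_rfl))
  have hint := integrableOn_Ioo_rpow (r := b - 1) (by linarith)
  refine (hasDerivAt_integral_of_dominated_loc_of_deriv_le
    (F := fun (z : ℂ) (w : ℝ) => ((w ^ (b - 1) : ℝ) : ℂ) * (1 - z * w) ^ ((-a : ℝ) : ℂ))
    (F' := fun z w => ((w ^ (b - 1) : ℝ) : ℂ) *
      (((-a : ℝ) : ℂ) * (1 - z * w) ^ (((-a : ℝ) : ℂ) - 1) * (-w)))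
    (bound := fun w => w ^ (b - 1) * (|a| * M'))
    (Metric.closedBall_mem_nhds z₀ hε) ?_ ?_ ?_ ?_ ?_ ?_).2.differentiableAt
  · filter_upwards [isOpen_one_sub_mem_slitPlane.mem_nhds hz₀] with z hz
    exact aestronglyMeasurable_eulerIntegrand hz _ _
  · refine Integrable.mono' (hint.mul_const M) (aestronglyMeasurable_eulerIntegrand hz₀ _ _) ?_
    filter_upwards [ae_restrict_mem measurableSet_Ioo] with w hw
    rw [norm_mul, Complex.norm_real, Real.norm_of_nonneg (Real.rpow_nonneg hw.1.le _)]
    exact mul_le_mul_of_nonneg_left (hM (z₀, w) ⟨Metric.mem_closedBall_self hε.le,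
      Ioo_subset_Icc_self hw⟩) (Real.rpow_nonneg hw.1.le _)
  · have h := (aestronglyMeasurable_eulerIntegrand hz₀ (b - 1) (((-a : ℝ) : ℂ) - 1)).mul
      (Complex.continuous_ofReal.aestronglyMeasurable.const_mul (a : ℂ))
    refine h.congr (Filter.Eventually.of_forall fun w => ?_)
    simp only [Complex.ofReal_neg, Pi.mul_apply]
    ring
  · filter_upwards [ae_restrict_mem measurableSet_Ioo] with w hw z hz
    rw [norm_mul, Complex.norm_real, Real.norm_of_nonneg (Real.rpow_nonneg hw.1.le _)]
    refine mul_le_mul_of_nonneg_left ?_ (Real.rpow_nonneg hw.1.le _)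
    have h1 := hM' (z, w) ⟨hz, Ioo_subset_Icc_self hw⟩
    rw [norm_mul, norm_mul, norm_neg, Complex.norm_real, Complex.norm_real, Real.norm_eq_abs,
      Real.norm_eq_abs, abs_neg, abs_of_pos hw.1]
    calc |a| * ‖(1 - z * w) ^ (((-a : ℝ) : ℂ) - 1)‖ * w
        ≤ |a| * ‖(1 - z * w) ^ (((-a : ℝ) : ℂ) - 1)‖ * 1 := by gcongr; exact hw.2.le
      _ ≤ |a| * M' := by rw [mul_one]; gcongr
  · exact hint.mul_const _
  · filter_upwards [ae_restrict_mem measurableSet_Ioo] with w hw z hz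
    refine HasDerivAt.const_mul _ ?_
    have h1 : HasDerivAt (fun z : ℂ => 1 - z * w) (-w : ℂ) z := by
      simpa using ((hasDerivAt_id z).mul_const (w : ℂ)).const_sub 1
    exact h1.cpow_const (one_sub_mul_mem_slitPlane (hball hz) (Ioo_subset_Icc_self hw))

lemma ringChoose_eq (a : ℂ) (n : ℕ) :
    Ring.choose (a + n - 1) n = (n.factorial : ℂ)⁻¹ * (ascPochhammer ℂ n).eval a := by
  have h := Ring.factorial_nsmul_multichoose_eq_ascPochhammer a n
  rw [Polynomial.ascPochhammer_smeval_eq_eval, nsmul_eq_mul] at h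
  rw [← h, Ring.choose, inv_mul_cancel_left₀ (by exact_mod_cast n.factorial_ne_zero)]
  congr 1
  ring

lemma hasSum_one_sub_cpow (a : ℂ) {z : ℂ} (hz : ‖z‖ < 1) :
    HasSum (fun n : ℕ => (n.factorial : ℂ)⁻¹ * (ascPochhammer ℂ n).eval a * z ^ n)
      ((1 - z) ^ (-a)) ∧
    Summable fun n : ℕ => ‖(n.factorial : ℂ)⁻¹ * (ascPochhammer ℂ n).eval a * z ^ n‖ := by
  have h := Complex.one_div_one_sub_cpow_hasFPowerSeriesOnBall_zero a
  have hmem : z ∈ Metric.eball (0 : ℂ) 1 := by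
    rw [mem_eball_zero_iff, ← ofReal_norm]
    exact ENNReal.ofReal_lt_one.2 hz
  have h1 := h.hasSum hmem
  have h2 := FormalMultilinearSeries.summable_norm_apply _
    (Metric.eball_subset_eball h.r_le hmem)
  simp only [FormalMultilinearSeries.ofScalars_apply_eq, ringChoose_eq, zero_add, smul_eq_mul,
    one_div, ← Complex.cpow_neg] at h1 h2
  exact ⟨h1, h2⟩

/-- Both sides are the rising factorial of length `n + 1`. This yields `(b)_n / (b+1)_n = b / (b +
n)`, the reason for the simple form of the series when `c = b + 1`. -/
lemma ascPochhammer_eval_mul_add (b : ℂ) (n : ℕ) :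
    (ascPochhammer ℂ n).eval b * (b + n) = b * (ascPochhammer ℂ n).eval (b + 1) := by
  have h1 := congrArg (Polynomial.eval b) (ascPochhammer_succ_right ℂ n)
  have h2 := congrArg (Polynomial.eval b) (ascPochhammer_succ_left ℂ n)
  simp only [Polynomial.eval_mul, Polynomial.eval_add, Polynomial.eval_X,
    Polynomial.eval_natCast, Polynomial.eval_comp, Polynomial.eval_one] at h1 h2
  rw [← h1, h2]

/-- Expand `(1 - z w)^(-a)` in its binomial series and integrate termwise, using `∫₀¹ w^(b-1+n) dw =
1/(b+n)`. The exchange is justified by absolute convergence of the binomial series at `z`, since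
`1/(b+n) ≤ 1/b`. -/
lemma eulerIntegral_eq_ordinaryHypergeometric (a : ℝ) {b : ℝ} (hb : 0 < b) {z : ℂ}
    (hz : ‖z‖ < 1) :
    eulerIntegral a b z = ordinaryHypergeometric (a : ℂ) (b : ℂ) ((b + 1 : ℝ) : ℂ) z := by
  set c : ℕ → ℂ := fun n => (n.factorial : ℂ)⁻¹ * (ascPochhammer ℂ n).eval (a : ℂ)
  set F : ℕ → ℝ → ℂ := fun n w => (c n * z ^ n) * ((w ^ (b - 1 + n) : ℝ) : ℂ)
  have hexp : ∀ n : ℕ, -1 < b - 1 + n := fun n => by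
    have : (0 : ℝ) ≤ n := n.cast_nonneg
    linarith
  have hF_int : ∀ n, Integrable (F n) (volume.restrict (Ioo 0 1)) := fun n =>
    ((integrableOn_Ioo_rpow (hexp n)).ofReal).const_mul _
  have hF_norm : ∀ n, ∫ w in Ioo (0 : ℝ) 1, ‖F n w‖ = ‖c n * z ^ n‖ * (b + n)⁻¹ := fun n => by
    rw [show (b + n)⁻¹ = ∫ w in Ioo (0 : ℝ) 1, w ^ (b - 1 + n) by
      rw [setIntegral_Ioo_rpow (hexp n)]; ring_nf, ← integral_const_mul]
    refine setIntegral_congr_fun measurableSet_Ioo fun w hw => ?_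
    simp only [F]
    rw [norm_mul, Complex.norm_real, Real.norm_of_nonneg (Real.rpow_nonneg hw.1.le _)]
  have hF_val : ∀ n, ∫ w in Ioo (0 : ℝ) 1, F n w = c n * z ^ n * ((b + n : ℝ) : ℂ)⁻¹ := fun n => by
    simp only [F]
    rw [integral_const_mul, integral_complex_ofReal, setIntegral_Ioo_rpow (hexp n)]
    push_cast
    ring_nf
  have hsum : Summable fun n => ∫ w in Ioo (0 : ℝ) 1, ‖F n w‖ := by
    simp_rw [hF_norm]
    refine Summable.of_nonneg_of_le (fun n => by positivity) (fun n => ?_)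
      ((hasSum_one_sub_cpow (a : ℂ) hz).2.mul_right b⁻¹)
    gcongr
    exact le_add_of_nonneg_right n.cast_nonneg
  have h := hasSum_integral_of_summable_integral_norm hF_int hsum
  have htsum : ∫ w in Ioo (0 : ℝ) 1, ∑' n, F n w = ∫ w in Ioo (0 : ℝ) 1,
      ((w ^ (b - 1) : ℝ) : ℂ) * (1 - z * w) ^ ((-a : ℝ) : ℂ) := by
    refine setIntegral_congr_fun measurableSet_Ioo fun w hw => ?_
    have hzw : ‖z * w‖ < 1 := by
      rw [norm_mul, Complex.norm_real, Real.norm_of_nonneg hw.1.le]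
      nlinarith [norm_nonneg z, hw.1, hw.2]
    have h1 := (hasSum_one_sub_cpow (a : ℂ) hzw).1.mul_left ((w ^ (b - 1) : ℝ) : ℂ)
    rw [← Complex.ofReal_neg] at h1
    rw [← h1.tsum_eq]
    refine tsum_congr fun n => ?_
    simp only [F, c]
    rw [Real.rpow_add hw.1, Real.rpow_natCast]
    push_cast
    ring
  rw [eulerIntegral, ← htsum, ← h.tsum_eq, ← tsum_mul_left,
    ordinaryHypergeometric_eq_tsum]
  refine tsum_congr fun n => ?_
  rw [hF_val, smul_eq_mul]
  have h3 := ascPochhammer_eval_mul_add (b : ℂ) n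
  have h4 : ((b + n : ℝ) : ℂ) ≠ 0 := by
    rw [Complex.ofReal_ne_zero]
    positivity
  -- The denominator vanishes only if `b + 1` is a nonpositive integer, which `b > 0` excludes.
  have h5 : (ascPochhammer ℂ n).eval ((b + 1 : ℝ) : ℂ) ≠ 0 := by
    rw [Ne, ascPochhammer_eval_eq_zero_iff]
    rintro ⟨k, -, hk⟩
    have hk' : (k : ℝ) = -(b + 1) := by exact_mod_cast hk
    have : (0 : ℝ) ≤ k := k.cast_nonneg
    linarith
  push_cast at h4 h5 ⊢
  simp only [c]
  rw [← div_eq_mul_inv, ← div_eq_mul_inv, mul_div_assoc', div_mul_eq_mul_div,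
    div_eq_div_iff h4 h5]
  linear_combination -((n.factorial : ℂ)⁻¹ * (ascPochhammer ℂ n).eval (a : ℂ) * z ^ n) * h3

lemma isGaussHypergeometric_eulerIntegral (a : ℝ) {b : ℝ} (hb : 0 < b) :
    IsGaussHypergeometric (a : ℂ) (b : ℂ) ((b + 1 : ℝ) : ℂ) (eulerIntegral a b) :=
  ⟨differentiableOn_eulerIntegral a hb,
    fun _ hz => eulerIntegral_eq_ordinaryHypergeometric a hb hz⟩

/-- The identity theorem on a domain star-shaped about 0. It identifies the chosen continuation with
Euler's integral. -/
lemma IsGaussHypergeometric.eqOn {a b c : ℂ} {F G : ℂ → ℂ} (hF : IsGaussHypergeometric a b c F)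
    (hG : IsGaussHypergeometric a b c G) : EqOn F G {z | 1 - z ∈ Complex.slitPlane} := by
  refine (hF.1.analyticOnNhd isOpen_one_sub_mem_slitPlane).eqOn_of_preconnected_of_eventuallyEq
    (hG.1.analyticOnNhd isOpen_one_sub_mem_slitPlane) isPreconnected_one_sub_mem_slitPlane
    (z₀ := 0) (by simp) ?_
  filter_upwards [Metric.ball_mem_nhds (0 : ℂ) one_pos] with z hz
  rw [mem_ball_zero_iff] at hz
  rw [hF.2 z hz, hG.2 z hz]

lemma gaussHypergeometric_eq_eulerIntegral (a : ℝ) {b : ℝ} (hb : 0 < b) {z : ℂ}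
    (hz : 1 - z ∈ Complex.slitPlane) :
    gaussHypergeometric (a : ℂ) (b : ℂ) ((b + 1 : ℝ) : ℂ) z = eulerIntegral a b z := by
  have h : ∃ F, IsGaussHypergeometric (a : ℂ) (b : ℂ) ((b + 1 : ℝ) : ℂ) F :=
    ⟨_, isGaussHypergeometric_eulerIntegral a hb⟩
  rw [gaussHypergeometric, dif_pos h]
  exact h.choose_spec.eqOn (isGaussHypergeometric_eulerIntegral a hb) hz

/-- `₂F₁(a, b; b + 1; -x)` for `x ≥ 0`, as a real integral. -/
theorem gaussHypergeometric_neg_ofReal (a : ℝ) {b : ℝ} (hb : 0 < b) {x : ℝ} (hx : 0 ≤ x) :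
    gaussHypergeometric (a : ℂ) (b : ℂ) ((b + 1 : ℝ) : ℂ) ((-x : ℝ) : ℂ) =
      ((b * ∫ w in Ioo (0 : ℝ) 1, w ^ (b - 1) * (1 + x * w) ^ (-a) : ℝ) : ℂ) := by
  rw [gaussHypergeometric_eq_eulerIntegral a hb, eulerIntegral, Complex.ofReal_mul,
    ← integral_complex_ofReal]
  · congr 1
    refine setIntegral_congr_fun measurableSet_Ioo fun w hw => ?_
    have h1 : 0 ≤ 1 + x * w := by
      have := hw.1.le
      positivity
    rw [Complex.ofReal_mul, Complex.ofReal_cpow h1]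
    push_cast
    ring_nf
  · rw [Complex.mem_slitPlane_iff]
    left
    simp only [Complex.ofReal_neg, sub_neg_eq_add, Complex.add_re, Complex.one_re,
      Complex.ofReal_re]
    linarith

end Hypergeometric

/-! ### Bounds for the Euler integral on the negative half line -/

section EulerBounds

open Set

/-- Euler's integral for `b⁻¹ ₂F₁(a, b; b + 1; -x)`. -/
def negEulerIntegral (a b x : ℝ) : ℝ := ∫ w in Ioo (0 : ℝ) 1, w ^ (b - 1) * (1 + x * w) ^ (-a)

variable {a b x : ℝ}

lemma integrableOn_negEulerIntegrand (ha : 0 ≤ a) (hb : 0 < b) (hx : 0 ≤ x) :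
    IntegrableOn (fun w : ℝ => w ^ (b - 1) * (1 + x * w) ^ (-a)) (Ioo 0 1) := by
  refine Integrable.mono' (integrableOn_Ioo_rpow (r := b - 1) (by linarith)) ?_ ?_
  · refine Measurable.aestronglyMeasurable ?_
    fun_prop
  · filter_upwards [ae_restrict_mem measurableSet_Ioo] with w hw
    have h1 : 1 ≤ 1 + x * w := le_add_of_nonneg_right (mul_nonneg hx hw.1.le)
    rw [Real.norm_of_nonneg (mul_nonneg (Real.rpow_nonneg hw.1.le _)
      (Real.rpow_nonneg (by linarith) _))]
    exact mul_le_of_le_one_right (Real.rpow_nonneg hw.1.le _)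
      (Real.rpow_le_one_of_one_le_of_nonpos h1 (by linarith))

/-- On the whole interval `1 + x w ≤ 2 x`. -/
lemma rpow_neg_left_le_negEulerIntegral (ha : 0 ≤ a) (hb : 0 < b) (hx : 1 ≤ x) :
    2 ^ (-a) * b⁻¹ * x ^ (-a) ≤ negEulerIntegral a b x := by
  have h0 : 2 ^ (-a) * b⁻¹ * x ^ (-a) = ∫ w in Ioo (0 : ℝ) 1, w ^ (b - 1) * (2 * x) ^ (-a) := by
    rw [integral_mul_const, setIntegral_Ioo_rpow (by linarith),
      Real.mul_rpow zero_le_two (by linarith), sub_add_cancel]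
    ring
  rw [h0, negEulerIntegral]
  refine setIntegral_mono_on ((integrableOn_Ioo_rpow (by linarith)).mul_const _)
    (integrableOn_negEulerIntegrand ha hb (by linarith)) measurableSet_Ioo fun w hw => ?_
  refine mul_le_mul_of_nonneg_left ?_ (Real.rpow_nonneg hw.1.le _)
  exact Real.rpow_le_rpow_of_nonpos (by nlinarith [hw.1]) (by nlinarith [hw.2]) (by linarith)

/-- On `(0, 1/x)` one has `1 + x w ≤ 2`, and the weight `w ^ (b - 1)` already has mass `x ^ (-b) /
b` there. -/
lemma rpow_neg_right_le_negEulerIntegral (ha : 0 ≤ a) (hb : 0 < b) (hx : 1 ≤ x) :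
    2 ^ (-a) * b⁻¹ * x ^ (-b) ≤ negEulerIntegral a b x := by
  have hx0 : 0 < x := by linarith
  have hsub : Ioo (0 : ℝ) x⁻¹ ⊆ Ioo 0 1 := Ioo_subset_Ioo_right (inv_le_one_of_one_le₀ hx)
  have h0 : 2 ^ (-a) * b⁻¹ * x ^ (-b) = ∫ w in Ioo (0 : ℝ) x⁻¹, w ^ (b - 1) * 2 ^ (-a) := by
    rw [integral_mul_const, ← integral_Ioc_eq_integral_Ioo,
      ← intervalIntegral.integral_of_le (by positivity), integral_rpow (Or.inl (by linarith)),
      sub_add_cancel, Real.zero_rpow hb.ne', Real.inv_rpow hx0.le, Real.rpow_neg hx0.le]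
    ring
  rw [h0, negEulerIntegral]
  refine (setIntegral_mono_on (((integrableOn_Ioo_rpow (by linarith)).mono_set hsub).mul_const _)
    ((integrableOn_negEulerIntegrand ha hb hx0.le).mono_set hsub) measurableSet_Ioo
    fun w hw => ?_).trans (setIntegral_mono_set (integrableOn_negEulerIntegrand ha hb hx0.le) ?_
      (Filter.Eventually.of_forall hsub))
  · refine mul_le_mul_of_nonneg_left ?_ (Real.rpow_nonneg hw.1.le _)
    have h1 : x * w ≤ 1 := by
      have := mul_le_mul_of_nonneg_left hw.2.le hx0.le
      rwa [mul_inv_cancel₀ hx0.ne'] at this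
    have h2 : 0 ≤ x * w := mul_nonneg hx0.le hw.1.le
    exact Real.rpow_le_rpow_of_nonpos (by linarith) (by linarith) (by linarith)
  · filter_upwards [ae_restrict_mem measurableSet_Ioo] with w hw
    have h2 : 0 ≤ x * w := mul_nonneg hx0.le hw.1.le
    exact mul_nonneg (Real.rpow_nonneg hw.1.le _) (Real.rpow_nonneg (by linarith) _)

lemma rpow_neg_min_le_negEulerIntegral (ha : 0 ≤ a) (hb : 0 < b) (hx : 1 ≤ x) :
    2 ^ (-a) * b⁻¹ * x ^ (-min a b) ≤ negEulerIntegral a b x := by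
  rcases min_choice a b with h | h <;> rw [h]
  · exact rpow_neg_left_le_negEulerIntegral ha hb hx
  · exact rpow_neg_right_le_negEulerIntegral ha hb hx

/-- Use `(1 + x w)^(-a) ≤ (1 + x w)^(-p) ≤ (x w)^(-p)`. The strict `p < b` keeps `w ^ (b - p - 1)`
integrable; giving up the endpoint sidesteps the logarithm occurring at `a = b`. -/
lemma negEulerIntegral_le {p : ℝ} (hp : 0 ≤ p) (hpa : p ≤ a) (hpb : p < b) (hx : 0 < x) :
    negEulerIntegral a b x ≤ (b - p)⁻¹ * x ^ (-p) := by
  have h0 : (b - p)⁻¹ * x ^ (-p) = ∫ w in Ioo (0 : ℝ) 1, w ^ (b - p - 1) * x ^ (-p) := by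
    rw [integral_mul_const, setIntegral_Ioo_rpow (by linarith), sub_add_cancel]
  rw [h0, negEulerIntegral]
  refine setIntegral_mono_on (integrableOn_negEulerIntegrand (hp.trans hpa) (hp.trans_lt hpb) hx.le)
    ((integrableOn_Ioo_rpow (by linarith)).mul_const _) measurableSet_Ioo fun w hw => ?_
  have hw0 := hw.1
  have h1 : 0 < x * w := mul_pos hx hw0
  calc w ^ (b - 1) * (1 + x * w) ^ (-a)
      ≤ w ^ (b - 1) * (1 + x * w) ^ (-p) := by
        gcongr
        linarith
    _ ≤ w ^ (b - 1) * (x * w) ^ (-p) := by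
        refine mul_le_mul_of_nonneg_left ?_ (Real.rpow_nonneg hw0.le _)
        exact Real.rpow_le_rpow_of_nonpos h1 (by linarith) (by linarith)
    _ = w ^ (b - p - 1) * x ^ (-p) := by
        rw [Real.mul_rpow hx.le hw0.le, mul_left_comm, ← Real.rpow_add hw0, mul_comm]
        ring_nf

end EulerBounds

/-! ### Integrating out the spatial frequency -/

section Marginal

open Set

variable {αt αs αe γt γs γe : ℝ}

/-- The map is `y ↦ (1 + y²/γs²)^(-αs)`, which decreases from 1 to 0; its inverse is explicit. -/
lemma substitution_image (hαs : 0 < αs) (hγs : 0 < γs) :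
    (fun y : ℝ => γs ^ (2 * αs) * (γs ^ 2 + y ^ 2) ^ (-αs)) '' Ioi 0 = Ioo 0 1 := by
  have hγ : γs ^ (2 * αs) = (γs ^ 2) ^ αs := by
    rw [← Real.rpow_natCast, ← Real.rpow_mul hγs.le]
    norm_num
  have hγ2 : 0 < γs ^ 2 := by positivity
  ext w
  constructor
  · rintro ⟨y, hy, rfl⟩
    rw [mem_Ioi] at hy
    refine ⟨by positivity, ?_⟩
    simp only
    rw [hγ, Real.rpow_neg (by positivity), ← div_eq_mul_inv, div_lt_one (by positivity)]
    exact Real.rpow_lt_rpow hγ2.le (by nlinarith) hαs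
  · rintro ⟨h0, h1⟩
    have h2 : 1 < w ^ (-αs⁻¹) := Real.one_lt_rpow_of_pos_of_lt_one_of_neg h0 h1 (by simpa)
    have h3 : 0 < γs ^ 2 * (w ^ (-αs⁻¹) - 1) := mul_pos hγ2 (by linarith)
    refine ⟨Real.sqrt (γs ^ 2 * (w ^ (-αs⁻¹) - 1)), Real.sqrt_pos.2 h3, ?_⟩
    simp only
    rw [Real.sq_sqrt h3.le, show γs ^ 2 + γs ^ 2 * (w ^ (-αs⁻¹) - 1) = γs ^ 2 * w ^ (-αs⁻¹) by ring,
      Real.mul_rpow hγ2.le (by positivity), ← Real.rpow_mul h0.le, hγ, ← mul_assoc,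
      ← Real.rpow_add hγ2, show -αs⁻¹ * -αs = 1 by field_simp]
    simp

lemma substitution_injOn (hαs : 0 < αs) (hγs : 0 < γs) :
    InjOn (fun y : ℝ => γs ^ (2 * αs) * (γs ^ 2 + y ^ 2) ^ (-αs)) (Ioi 0) := by
  intro y hy y' hy' h
  rw [mem_Ioi] at hy hy'
  have h1 := mul_left_cancel₀ (by positivity : γs ^ (2 * αs) ≠ 0) h
  have h2 := Real.rpow_left_injOn (neg_ne_zero.2 hαs.ne')
    (by simp only [mem_ofPred_eq]; positivity) (by simp only [mem_ofPred_eq]; positivity) h1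
  have h3 : y ^ 2 = y' ^ 2 := by linarith
  exact (pow_left_inj₀ hy.le hy'.le two_ne_zero).1 h3

lemma substitution_hasDerivAt (hγs : 0 < γs) (y : ℝ) :
    HasDerivAt (fun y : ℝ => γs ^ (2 * αs) * (γs ^ 2 + y ^ 2) ^ (-αs))
      (γs ^ (2 * αs) * (2 * y * -αs * (γs ^ 2 + y ^ 2) ^ (-αs - 1))) y := by
  refine HasDerivAt.const_mul _ ?_
  have h : HasDerivAt (fun y : ℝ => γs ^ 2 + y ^ 2) (2 * y) y := by
    simpa using (hasDerivAt_pow 2 y).const_add (γs ^ 2)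
  exact h.rpow_const (Or.inl (by positivity))

/-- The radial profile, in the spatial frequency, of the space-time spectrum. -/
def radialProfile (αt αs αe γt γs ωt y : ℝ) : ℝ :=
  (γt ^ 2 * ωt ^ 2 + (γs ^ 2 + y ^ 2) ^ αs) ^ (-αt) * (γs ^ 2 + y ^ 2) ^ (-αe)

/-- Factoring `v^(-αs)` out of `1 + γt² ωt² v^(-αs)` releases `v^(αs αt)`. With the Jacobian power
`v^(-αs-1)` and `w^(b-1)` this must leave `v^(-αe)`, which fixes the value of `b`. -/
lemma substitution_integrand (hαs : 0 < αs) (hγs : 0 < γs) (ωt : ℝ) {b : ℝ}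
    (hb : b = (αe - 1) / αs + αt) {y : ℝ} (hy : 0 < y) :
    |γs ^ (2 * αs) * (2 * y * -αs * (γs ^ 2 + y ^ 2) ^ (-αs - 1))| •
      ((γs ^ (2 * αs) * (γs ^ 2 + y ^ 2) ^ (-αs)) ^ (b - 1) *
        (1 + γt ^ 2 * γs ^ (-2 * αs) * ωt ^ 2 *
          (γs ^ (2 * αs) * (γs ^ 2 + y ^ 2) ^ (-αs))) ^ (-αt)) =
      (2 * αs * γs ^ (2 * αs * b)) * (y * radialProfile αt αs αe γt γs ωt y) := by
  set v := γs ^ 2 + y ^ 2 with hv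
  have hv0 : 0 < v := by positivity
  have hexp : -αs * (b - 1) = -αe + αs + 1 - αs * αt := by
    rw [hb]
    field_simp
    ring
  have h1 : |γs ^ (2 * αs) * (2 * y * -αs * v ^ (-αs - 1))| =
      2 * αs * γs ^ (2 * αs) * y * v ^ (-αs - 1) := by
    rw [show γs ^ (2 * αs) * (2 * y * -αs * v ^ (-αs - 1)) =
      -(2 * αs * γs ^ (2 * αs) * y * v ^ (-αs - 1)) by ring, abs_neg, abs_of_pos (by positivity)]
  have h2 : γt ^ 2 * γs ^ (-2 * αs) * ωt ^ 2 * (γs ^ (2 * αs) * v ^ (-αs)) =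
      γt ^ 2 * ωt ^ 2 * v ^ (-αs) := by
    have : γs ^ (-2 * αs) * γs ^ (2 * αs) = 1 := by
      rw [← Real.rpow_add hγs]
      simp
    linear_combination γt ^ 2 * ωt ^ 2 * v ^ (-αs) * this
  have h3 : (1 + γt ^ 2 * ωt ^ 2 * v ^ (-αs)) ^ (-αt) =
      (γt ^ 2 * ωt ^ 2 + v ^ αs) ^ (-αt) * v ^ (αs * αt) := by
    have h4 : 1 + γt ^ 2 * ωt ^ 2 * v ^ (-αs) = (γt ^ 2 * ωt ^ 2 + v ^ αs) * v ^ (-αs) := by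
      rw [add_mul, ← Real.rpow_add hv0]
      simp [add_comm]
    rw [h4, Real.mul_rpow (by positivity) (by positivity), ← Real.rpow_mul hv0.le, neg_mul_neg]
  rw [smul_eq_mul, h1, h2, h3, Real.mul_rpow (by positivity) (by positivity),
    ← Real.rpow_mul hγs.le, ← Real.rpow_mul hv0.le, hexp, radialProfile, ← hv]
  have h5 : γs ^ (2 * αs * b) = γs ^ (2 * αs) * γs ^ (2 * αs * (b - 1)) := by
    rw [← Real.rpow_add hγs]
    ring_nf
  have h6 : v ^ (-αe) = v ^ (-αs - 1) * v ^ (-αe + αs + 1 - αs * αt) * v ^ (αs * αt) := by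
    rw [← Real.rpow_add hv0, ← Real.rpow_add hv0]
    ring_nf
  rw [h5, h6]
  ring

variable {b : ℝ}

lemma integrableOn_radialProfile (hαt : 0 ≤ αt) (hαs : 0 < αs) (hγs : 0 < γs) (ωt : ℝ)
    (hb : b = (αe - 1) / αs + αt) (hb0 : 0 < b) :
    IntegrableOn (fun y => y * radialProfile αt αs αe γt γs ωt y) (Ioi 0) := by
  have h1 := integrableOn_negEulerIntegrand hαt hb0
    (x := γt ^ 2 * γs ^ (-2 * αs) * ωt ^ 2) (by positivity)
  rw [← substitution_image hαs hγs, integrableOn_image_iff_integrableOn_abs_deriv_smul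
    measurableSet_Ioi (fun y _ => (substitution_hasDerivAt hγs y).hasDerivWithinAt)
    (substitution_injOn hαs hγs)] at h1
  have h2 := h1.congr_fun (fun y hy => substitution_integrand hαs hγs ωt hb hy) measurableSet_Ioi
  refine (integrable_const_mul_iff (IsUnit.mk0 _ ?_) _).1 h2
  positivity

lemma setIntegral_radialProfile (hαs : 0 < αs) (hγs : 0 < γs) (ωt : ℝ)
    (hb : b = (αe - 1) / αs + αt) :
    ∫ y in Ioi 0, y * radialProfile αt αs αe γt γs ωt y =
      (2 * αs * γs ^ (2 * αs * b))⁻¹ *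
        negEulerIntegral αt b (γt ^ 2 * γs ^ (-2 * αs) * ωt ^ 2) := by
  rw [negEulerIntegral, ← substitution_image hαs hγs, integral_image_eq_integral_abs_deriv_smul
    measurableSet_Ioi (fun y _ => (substitution_hasDerivAt hγs y).hasDerivWithinAt)
    (substitution_injOn hαs hγs), setIntegral_congr_fun measurableSet_Ioi
    (fun y hy => substitution_integrand hαs hγs ωt hb hy), integral_const_mul,
    inv_mul_cancel_left₀]
  positivity

lemma fieldSpectrum_toLp (ωs : Space) (ωt : ℝ) :
    fieldSpectrum αt αs αe γt γs γe (WithLp.toLp 2 (ωs, ωt)) =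
      ((2 * Real.pi) ^ 3)⁻¹ * (γe ^ 2)⁻¹ * radialProfile αt αs αe γt γs ωt ‖ωs‖ := rfl

/-- The marginal temporal spectrum of the solution. -/
def marginalSpectrum (αt αs αe γt γs γe ωt : ℝ) : ℝ :=
  ∫ ωs : Space, fieldSpectrum αt αs αe γt γs γe (WithLp.toLp 2 (ωs, ωt))

/-- Polar coordinates in the plane supply the factor `y` for which the substitution is set up. -/
lemma integrable_fieldSpectrum_slice (hαt : 0 ≤ αt) (hαs : 0 < αs) (hγs : 0 < γs) (ωt : ℝ)
    (hb : b = (αe - 1) / αs + αt) (hb0 : 0 < b) :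
    Integrable fun ωs : Space => fieldSpectrum αt αs αe γt γs γe (WithLp.toLp 2 (ωs, ωt)) := by
  simp_rw [fieldSpectrum_toLp]
  refine Integrable.const_mul ?_ _
  rw [integrable_fun_norm_addHaar volume (f := radialProfile αt αs αe γt γs ωt)]
  simpa using integrableOn_radialProfile (γt := γt) hαt hαs hγs ωt hb hb0

/-- The marginal temporal spectrum in terms of Euler's integral. -/
theorem exists_marginalSpectrum_eq (hαs : 0 < αs) (hγs : 0 < γs) (hγe : 0 < γe) (γt : ℝ)
    (hb : b = (αe - 1) / αs + αt) :
    ∃ C : ℝ, 0 < C ∧ ∀ ωt, marginalSpectrum αt αs αe γt γs γe ωt =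
      C * negEulerIntegral αt b (γt ^ 2 * γs ^ (-2 * αs) * ωt ^ 2) := by
  have hball : 0 < volume.real (Metric.ball (0 : Space) 1) :=
    ENNReal.toReal_pos (Metric.measure_ball_pos volume 0 one_pos).ne' measure_ball_lt_top.ne
  refine ⟨((2 * Real.pi) ^ 3)⁻¹ * (γe ^ 2)⁻¹ * (2 * volume.real (Metric.ball (0 : Space) 1) *
    (2 * αs * γs ^ (2 * αs * b))⁻¹), by positivity, fun ωt => ?_⟩
  have h := integral_fun_norm_addHaar (volume : Measure Space)
    (radialProfile αt αs αe γt γs ωt)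
  have h2 : ∫ y in Ioi (0 : ℝ), y ^ (Module.finrank ℝ Space - 1) •
      radialProfile αt αs αe γt γs ωt y = ∫ y in Ioi 0, y * radialProfile αt αs αe γt γs ωt y := by
    simp
  rw [h2, setIntegral_radialProfile hαs hγs ωt hb, finrank_euclideanSpace_fin] at h
  simp_rw [marginalSpectrum, fieldSpectrum_toLp]
  rw [integral_const_mul, h, nsmul_eq_mul, smul_eq_mul]
  push_cast
  ring

end Marginal

/-! ### Approximate point evaluations -/

section Mollifier

open Filter

/-- A bump function centred at `x` with support of radius `1 / (n + 1)`. -/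
def bumpAt (x : SpaceTime) (n : ℕ) : ContDiffBump x where
  rIn := 1 / (n + 1) / 2
  rOut := 1 / (n + 1)
  rIn_pos := by positivity
  rIn_lt_rOut := half_lt_self (by positivity)

/-- A test function of integral one supported in the ball of radius `1 / (n + 1)` about `x`. -/
def mollifier (x : SpaceTime) (n : ℕ) : 𝓢(SpaceTime, ℝ) :=
  ((bumpAt x n).hasCompactSupport_normed (μ := volume)).toSchwartzMap
    (bumpAt x n).contDiff_normed

lemma mollifier_apply (x : SpaceTime) (n : ℕ) (y : SpaceTime) :
    mollifier x n y = (bumpAt x n).normed volume y := rfl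

lemma mollifier_nonneg (x : SpaceTime) (n : ℕ) (y : SpaceTime) : 0 ≤ mollifier x n y :=
  (bumpAt x n).nonneg_normed y

lemma integral_mollifier (x : SpaceTime) (n : ℕ) : ∫ y, mollifier x n y = 1 :=
  (bumpAt x n).integral_normed

lemma mollifier_eq_zero {x y : SpaceTime} {n : ℕ} (h : 1 / ((n : ℝ) + 1) ≤ dist y x) :
    mollifier x n y = 0 := by
  rw [mollifier_apply]
  by_contra h0
  have h1 : y ∈ Function.support ((bumpAt x n).normed volume) := h0
  rw [(bumpAt x n).support_normed_eq, Metric.mem_ball] at h1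
  exact absurd h1 (not_lt.2 h)

variable {F : Type*} [NormedAddCommGroup F] [NormedSpace ℝ F]

lemma integrable_mollifier_smul (x : SpaceTime) (n : ℕ) {g : SpaceTime → F} (hg : Continuous g) :
    Integrable fun y => mollifier x n y • g y := by
  refine ((mollifier x n).continuous.smul hg).integrable_of_hasCompactSupport ?_
  exact ((bumpAt x n).hasCompactSupport_normed (μ := volume)).smul_right

/-- The mollifiers are probability densities on shrinking balls, so only the oscillation of `g` near
`x` matters. It is used both for `L²`-valued fields and for complex exponentials. -/
lemma tendsto_integral_mollifier_smul [CompleteSpace F] (x : SpaceTime) {g : SpaceTime → F}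
    (hg : Continuous g) :
    Tendsto (fun n => ∫ y, mollifier x n y • g y) atTop (𝓝 (g x)) := by
  rw [Metric.tendsto_atTop]
  intro ε hε
  obtain ⟨δ, hδ, hδg⟩ := Metric.continuous_iff.1 hg x (ε / 2) (by positivity)
  obtain ⟨N, hN⟩ := exists_nat_one_div_lt hδ
  refine ⟨N, fun n hn => lt_of_le_of_lt ?_ (half_lt_self hε)⟩
  have h1 : (∫ y, mollifier x n y • g y) - g x = ∫ y, mollifier x n y • (g y - g x) := by
    simp_rw [smul_sub]
    rw [integral_sub (integrable_mollifier_smul x n hg)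
      (integrable_mollifier_smul x n continuous_const), integral_smul_const, integral_mollifier,
      one_smul]
  rw [dist_eq_norm, h1]
  calc ‖∫ y, mollifier x n y • (g y - g x)‖
      ≤ ∫ y, mollifier x n y * (ε / 2) := by
        refine norm_integral_le_of_norm_le ((mollifier x n).integrable.mul_const _)
          (Eventually.of_forall fun y => ?_)
        rw [norm_smul, Real.norm_of_nonneg (mollifier_nonneg x n y)]
        by_cases hy : 1 / ((n : ℝ) + 1) ≤ dist y x
        · simp [mollifier_eq_zero hy]
        · refine mul_le_mul_of_nonneg_left ?_ (mollifier_nonneg x n y)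
          rw [← dist_eq_norm]
          refine (hδg y ((not_le.1 hy).trans_le ((Nat.one_div_le_one_div hn).trans hN.le))).le
    _ = ε / 2 := by rw [integral_mul_const, integral_mollifier, one_mul]

lemma angularFourier_mollifier (x : SpaceTime) (n : ℕ) (ω : SpaceTime) :
    angularFourier (mollifier x n) ω =
      ∫ y, mollifier x n y • Complex.exp (-(Complex.I * (inner ℝ ω y : ℝ))) := by
  rw [angularFourier, Real.fourier_eq]
  congr 1 with y
  rw [Circle.smul_def, Real.fourierChar_apply, Complex.real_smul, smul_eq_mul, mul_comm,
    real_inner_smul_right, real_inner_comm]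
  congr 2
  push_cast
  have : (Real.pi : ℂ) ≠ 0 := by exact_mod_cast Real.pi_ne_zero
  field_simp

lemma norm_exp_neg_I_mul (r : ℝ) : ‖Complex.exp (-(Complex.I * r))‖ = 1 := by
  rw [Complex.norm_exp]
  simp

lemma norm_angularFourier_mollifier_le (x : SpaceTime) (n : ℕ) (ω : SpaceTime) :
    ‖angularFourier (mollifier x n) ω‖ ≤ 1 := by
  rw [angularFourier_mollifier, ← integral_mollifier x n]
  refine norm_integral_le_of_norm_le (mollifier x n).integrable (Eventually.of_forall fun y => ?_)
  rw [norm_smul, norm_exp_neg_I_mul, mul_one, Real.norm_of_nonneg (mollifier_nonneg x n y)]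

lemma tendsto_angularFourier_mollifier (x ω : SpaceTime) :
    Tendsto (fun n => angularFourier (mollifier x n) ω) atTop
      (𝓝 (Complex.exp (-(Complex.I * (inner ℝ ω x : ℝ))))) := by
  simp_rw [angularFourier_mollifier]
  refine tendsto_integral_mollifier_smul x
    (g := fun y => Complex.exp (-(Complex.I * (inner ℝ ω y : ℝ)))) ?_
  fun_prop

lemma continuous_angularFourier (φ : 𝓢(SpaceTime, ℝ)) : Continuous (angularFourier φ) := by
  have h : angularFourier φ = fun ω => 𝓕 (complexify φ) ((2 * Real.pi)⁻¹ • ω) := by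
    ext ω
    rw [angularFourier, fourier_complexify]
  rw [h]
  exact (𝓕 (complexify φ)).continuous.comp (continuous_const_smul _)

end Mollifier

/-! ### Covariance of a pointwise version -/

section PointwiseVersion

open Filter

variable {Ω : Type*} [MeasurableSpace Ω] {P : Measure Ω}

/-- Writing the mean as an inner product makes its continuity on `L²` immediate. -/
lemma integral_eq_inner_one [IsProbabilityMeasure P] (Z : Lp ℝ 2 P) :
    ∫ w, Z w ∂P = inner ℝ ((memLp_const (1 : ℝ)).toLp (fun _ : Ω => (1 : ℝ)) : Lp ℝ 2 P) Z := by
  rw [L2.inner_def]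
  refine integral_congr_ae ?_
  filter_upwards [(memLp_const (1 : ℝ) : MemLp (fun _ : Ω => (1 : ℝ)) 2 P).coeFn_toLp] with w hw
  rw [hw]
  simp

lemma covariance_eq_inner {X Y : Ω → ℝ} {A B : Lp ℝ 2 P} (hX : X =ᵐ[P] A) (hY : Y =ᵐ[P] B)
    (hX0 : ∫ w, X w ∂P = 0) (hY0 : ∫ w, Y w ∂P = 0) : cov[X, Y; P] = inner ℝ A B := by
  rw [covariance, hX0, hY0, L2.inner_def]
  refine integral_congr_ae ?_
  filter_upwards [hX, hY] with w h1 h2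
  simp [h1, h2, mul_comm]

variable {u : 𝓢(SpaceTime, ℝ) → Ω → ℝ} {U : Space → ℝ → Ω → ℝ} {S : SpaceTime → ℝ}

namespace IsPointwiseVersion

/-- A pointwise version, as a map to `L²`. -/
def curve (hU : IsPointwiseVersion P u U) (x : SpaceTime) : Lp ℝ 2 P :=
  (hU.memLp x.fst x.snd).toLp (U x.fst x.snd)

/-- The average of a pointwise version with respect to a test function. -/
def average (hU : IsPointwiseVersion P u U) (φ : 𝓢(SpaceTime, ℝ)) : Lp ℝ 2 P :=
  ∫ x, φ x • hU.curve x

lemma tendsto_average_mollifier (hU : IsPointwiseVersion P u U) (x : SpaceTime) :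
    Tendsto (fun n => hU.average (mollifier x n)) atTop (𝓝 (hU.curve x)) :=
  tendsto_integral_mollifier_smul x hU.continuous

lemma integral_eq_zero [IsProbabilityMeasure P] (hU : IsPointwiseVersion P u U)
    (hu : ∀ φ, ∫ w, u φ w ∂P = 0) (x : SpaceTime) : ∫ w, U x.fst x.snd w ∂P = 0 := by
  rw [integral_congr_ae (hU.memLp x.fst x.snd).coeFn_toLp.symm, integral_eq_inner_one]
  refine tendsto_nhds_unique (tendsto_const_nhds.inner (hU.tendsto_average_mollifier x)) ?_
  refine tendsto_const_nhds.congr fun n => ?_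
  rw [← integral_eq_inner_one, ← hu (mollifier x n)]
  exact integral_congr_ae (hU.eq_integral _)

lemma covariance_eq_inner_curve [IsProbabilityMeasure P] (hU : IsPointwiseVersion P u U)
    (hu : ∀ φ, ∫ w, u φ w ∂P = 0) (x y : SpaceTime) :
    cov[U x.fst x.snd, U y.fst y.snd; P] = inner ℝ (hU.curve x) (hU.curve y) :=
  covariance_eq_inner (hU.memLp x.fst x.snd).coeFn_toLp.symm
    (hU.memLp y.fst y.snd).coeFn_toLp.symm (hU.integral_eq_zero hu x) (hU.integral_eq_zero hu y)

lemma tendsto_covariance_mollifier (hU : IsPointwiseVersion P u U)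
    (hu : ∀ φ, ∫ w, u φ w ∂P = 0) (x y : SpaceTime) :
    Tendsto (fun n => cov[u (mollifier x n), u (mollifier y n); P]) atTop
      (𝓝 (inner ℝ (hU.curve x) (hU.curve y))) := by
  refine ((hU.tendsto_average_mollifier x).inner (hU.tendsto_average_mollifier y)).congr
    fun n => ?_
  exact (covariance_eq_inner (hU.eq_integral _) (hU.eq_integral _) (hu _) (hu _)).symm

/-- Fatou's lemma: `|angularFourier (mollifier 0 n)|²` tends to 1, and its integrals against `S` are
variances converging to `‖hU.curve 0‖²`. -/
lemma integrable_spectrum (hU : IsPointwiseVersion P u U) (hu : ∀ φ, ∫ w, u φ w ∂P = 0)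
    (hS : IsSpectrum P u S) : Integrable S := by
  refine ⟨hS.measurable.aestronglyMeasurable, ?_⟩
  set f : ℕ → SpaceTime → ℝ≥0∞ := fun n ω =>
    ENNReal.ofReal (‖angularFourier (mollifier 0 n) ω‖ ^ 2 * S ω) with hf
  have hmeas : ∀ n, Measurable (f n) := fun n =>
    (((continuous_angularFourier _).norm.pow 2).measurable.mul hS.measurable).ennreal_ofReal
  have hlim : ∀ ω, Tendsto (fun n => f n ω) atTop (𝓝 (ENNReal.ofReal (S ω))) := fun ω => by
    refine ENNReal.tendsto_ofReal ?_
    have h1 := ((tendsto_angularFourier_mollifier 0 ω).norm.pow 2).mul_const (S ω)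
    rwa [norm_exp_neg_I_mul, one_pow, one_mul] at h1
  have hval : ∀ n, ∫⁻ ω, f n ω =
      ENNReal.ofReal (cov[u (mollifier 0 n), u (mollifier 0 n); P]) := fun n => by
    have h1 := hS.integrable (mollifier 0 n) (mollifier 0 n)
    have h2 := hS.covariance_eq (mollifier 0 n) (mollifier 0 n)
    have h3 : ∀ ω, (starRingEnd ℂ) (angularFourier (mollifier 0 n) ω) *
        angularFourier (mollifier 0 n) ω * (S ω : ℂ) =
        ((‖angularFourier (mollifier 0 n) ω‖ ^ 2 * S ω : ℝ) : ℂ) := fun ω => by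
      rw [mul_comm ((starRingEnd ℂ) _), Complex.mul_conj, Complex.normSq_eq_norm_sq,
        Complex.ofReal_mul]
    simp_rw [h3] at h1 h2
    rw [integral_complex_ofReal, Complex.ofReal_inj] at h2
    rw [h2, ofReal_integral_eq_lintegral_ofReal]
    · simpa only [RCLike.re_eq_complex_re, Complex.ofReal_re] using h1.re
    · exact Eventually.of_forall fun ω => mul_nonneg (by positivity) (hS.nonneg ω)
  rw [hasFiniteIntegral_iff_ofReal (Eventually.of_forall hS.nonneg)]
  calc ∫⁻ ω, ENNReal.ofReal (S ω) = ∫⁻ ω, liminf (fun n => f n ω) atTop := by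
        refine lintegral_congr fun ω => (hlim ω).liminf_eq.symm
    _ ≤ liminf (fun n => ∫⁻ ω, f n ω) atTop := lintegral_liminf_le hmeas
    _ = ENNReal.ofReal (inner ℝ (hU.curve 0) (hU.curve 0)) := by
        simp_rw [hval]
        exact (ENNReal.tendsto_ofReal (hU.tendsto_covariance_mollifier hu 0 0)).liminf_eq
    _ < ∞ := ENNReal.ofReal_lt_top

/-- Mollified covariances converge on both sides: in `L²` by continuity of the field, and in
frequency by dominated convergence, with `S` itself as the bound. -/
theorem inner_curve_eq (hU : IsPointwiseVersion P u U) (hu : ∀ φ, ∫ w, u φ w ∂P = 0)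
    (hS : IsSpectrum P u S) (x y : SpaceTime) :
    ((inner ℝ (hU.curve x) (hU.curve y) : ℝ) : ℂ) =
      ∫ ω, Complex.exp (Complex.I * (inner ℝ ω (x - y) : ℝ)) * (S ω : ℂ) := by
  have h1 : Tendsto (fun n => ((cov[u (mollifier x n), u (mollifier y n); P] : ℝ) : ℂ)) atTop
      (𝓝 ((inner ℝ (hU.curve x) (hU.curve y) : ℝ) : ℂ)) :=
    (Complex.continuous_ofReal.tendsto _).comp (hU.tendsto_covariance_mollifier hu x y)
  refine tendsto_nhds_unique h1 ?_
  simp_rw [hS.covariance_eq]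
  refine tendsto_integral_of_dominated_convergence S
    (fun n => (hS.integrable _ _).aestronglyMeasurable) (hU.integrable_spectrum hu hS)
    (fun n => Eventually.of_forall fun ω => ?_) (Eventually.of_forall fun ω => ?_)
  · rw [norm_mul, norm_mul, RCLike.norm_conj, Complex.norm_real,
      Real.norm_of_nonneg (hS.nonneg ω)]
    refine mul_le_of_le_one_left (hS.nonneg ω) (mul_le_one₀ ?_ (norm_nonneg _) ?_)
    · exact norm_angularFourier_mollifier_le x n ω
    · exact norm_angularFourier_mollifier_le y n ω
  · refine Tendsto.mul_const _ ?_
    have h2 := ((Complex.continuous_conj.tendsto _).comp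
      (tendsto_angularFourier_mollifier x ω)).mul (tendsto_angularFourier_mollifier y ω)
    refine (congrArg (fun c => Tendsto _ atTop (𝓝 c)) ?_).mpr h2
    rw [← Complex.exp_conj, ← Complex.exp_add, inner_sub_right]
    congr 1
    simp only [map_neg, map_mul, Complex.conj_I, Complex.conj_ofReal]
    push_cast
    ring

end IsPointwiseVersion

/-! ### The temporal spectrum of a pointwise version -/

/-- For two points with the same spatial coordinate the phase depends on `ωt` only, so Fubini
integrates out `ωs`. -/
theorem IsPointwiseVersion.isProcessSpectrum [IsProbabilityMeasure P]
    (hU : IsPointwiseVersion P u U) (hu : ∀ φ, ∫ w, u φ w ∂P = 0) (hS : IsSpectrum P u S) (s : Space) :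
    IsProcessSpectrum P (U s) (fun ωt => ∫ ωs : Space, S (WithLp.toLp 2 (ωs, ωt))) := by
  have hmp := WithLp.volume_preserving_toLp Space ℝ
  have hemb : MeasurableEmbedding (@WithLp.toLp 2 (Space × ℝ)) :=
    (MeasurableEquiv.toLp 2 (Space × ℝ)).measurableEmbedding
  have hSint := hU.integrable_spectrum hu hS
  have hSint' : Integrable (fun p : Space × ℝ => S (WithLp.toLp 2 p))
      ((volume : Measure Space).prod volume) :=
    (hmp.integrable_comp_emb hemb).2 hSint
  refine ⟨fun ωt => integral_nonneg fun ωs => hS.nonneg _, hSint'.integral_prod_right,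
    fun t₁ t₂ => ?_⟩
  have h1 := hU.covariance_eq_inner_curve hu (WithLp.toLp 2 (s, t₁)) (WithLp.toLp 2 (s, t₂))
  change cov[U s t₁, U s t₂; P] = _ at h1
  rw [h1, hU.inner_curve_eq hu hS, ← hmp.integral_comp hemb]
  have h2 : ∀ p : Space × ℝ, Complex.exp (Complex.I * (inner ℝ (WithLp.toLp 2 p : SpaceTime)
      (WithLp.toLp 2 (s, t₁) - WithLp.toLp 2 (s, t₂)) : ℝ)) * (S (WithLp.toLp 2 p) : ℂ) =
      Complex.exp (Complex.I * (p.2 * (t₁ - t₂) : ℝ)) * (S (WithLp.toLp 2 p) : ℂ) := fun p => by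
    congr 4
    simp [WithLp.prod_inner_apply, mul_comm]
  simp_rw [h2]
  change ∫ p, _ ∂((volume : Measure Space).prod volume) = _
  rw [integral_prod_symm]
  · congr 1 with ωt
    rw [← integral_complex_ofReal, ← integral_const_mul]
  · refine hSint'.ofReal.bdd_mul (c := 1) ?_ (Eventually.of_forall fun p => ?_)
    · exact Continuous.aestronglyMeasurable (by fun_prop)
    · rw [← norm_exp_neg_I_mul (-(p.2 * (t₁ - t₂)))]
      simp

end PointwiseVersion

/-! ### Stationary curves in a Hilbert space -/

section Wave

/-- The oscillation `exp(iωt)`, as a function of `ω`. -/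
def wave (t ω : ℝ) : ℂ := Complex.exp (Complex.I * (ω * t : ℝ))

lemma norm_wave (t ω : ℝ) : ‖wave t ω‖ = 1 := by
  rw [wave, Complex.norm_exp]
  simp

lemma continuous_wave (t : ℝ) : Continuous (wave t) := by
  unfold wave
  fun_prop

lemma wave_add (s t ω : ℝ) : wave (s + t) ω = wave s ω * wave t ω := by
  rw [wave, wave, wave, ← Complex.exp_add]
  push_cast
  ring_nf

lemma conj_wave (t ω : ℝ) : (starRingEnd ℂ) (wave t ω) = wave (-t) ω := by
  rw [wave, wave, ← Complex.exp_conj]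
  simp

lemma wave_zero (ω : ℝ) : wave 0 ω = 1 := by simp [wave]

lemma wave_mul_conj_wave (s t ω : ℝ) :
    wave s ω * (starRingEnd ℂ) (wave t ω) = wave (s - t) ω := by
  rw [conj_wave, ← wave_add, sub_eq_add_neg]

lemma norm_wave_sub_one_le (t ω : ℝ) : ‖wave t ω - 1‖ ≤ |ω * t| :=
  Real.norm_exp_I_mul_ofReal_sub_one_le

lemma norm_wave_sub_wave_le (s t ω : ℝ) : ‖wave s ω - wave t ω‖ ≤ |ω| * |s - t| := by
  have h : wave s ω - wave t ω = wave t ω * (wave (s - t) ω - 1) := by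
    rw [mul_sub, ← wave_add, mul_one]
    congr 2
    ring
  rw [h, norm_mul, norm_wave, one_mul, ← abs_mul]
  exact norm_wave_sub_one_le _ _

lemma norm_wave_sub_wave_le_two (s t ω : ℝ) : ‖wave s ω - wave t ω‖ ≤ 2 := by
  refine (norm_sub_le _ _).trans ?_
  rw [norm_wave, norm_wave]
  norm_num

/-- Interpolates between the linear bound and the trivial bound 2, according to whether `|ω| |s -
t|` is below or above 1. -/
lemma norm_wave_sub_wave_le_rpow {θ : ℝ} (h0 : 0 ≤ θ) (h1 : θ ≤ 1) (s t ω : ℝ) :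
    ‖wave s ω - wave t ω‖ ≤ 2 * (|ω| ^ θ * |s - t| ^ θ) := by
  rw [← Real.mul_rpow (abs_nonneg _) (abs_nonneg _)]
  set x := |ω| * |s - t|
  have hx : 0 ≤ x := by positivity
  rcases le_total x 1 with hx1 | hx1
  · have h2 : x ≤ x ^ θ := by
      rcases hx.eq_or_lt with h | h
      · rw [← h]
        exact Real.rpow_nonneg le_rfl _
      · simpa using Real.rpow_le_rpow_of_exponent_ge h hx1 h1
    have := norm_wave_sub_wave_le s t ω
    have := Real.rpow_nonneg hx θ
    linarith
  · have h2 : 1 ≤ x ^ θ := Real.one_le_rpow hx1 h0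
    have := norm_wave_sub_wave_le_two s t ω
    linarith

lemma hasDerivAt_wave (t ω : ℝ) :
    HasDerivAt (fun t => wave t ω) (Complex.I * ω * wave t ω) t := by
  have h1 : HasDerivAt (fun t : ℝ => Complex.I * ((ω * t : ℝ) : ℂ)) (Complex.I * ω) t := by
    have := ((hasDerivAt_id t).const_mul ω).ofReal_comp.const_mul Complex.I
    simpa using this
  have h2 := h1.cexp
  rw [mul_comm] at h2
  exact h2

/-- Jordan's inequality `sin x ≥ 2x/π` for the imaginary part. -/
lemma inv_pi_le_norm_wave_sub_one {t ω : ℝ} (h1 : 1 / 2 ≤ ω * t) (h2 : ω * t ≤ 1) :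
    Real.pi⁻¹ ≤ ‖wave t ω - 1‖ := by
  have h3 : (wave t ω - 1).im = Real.sin (ω * t) := by
    rw [wave, mul_comm, Complex.sub_im, Complex.exp_ofReal_mul_I_im]
    simp
  have h4 := Real.mul_le_sin (x := ω * t) (by linarith) (by linarith [Real.pi_gt_three])
  have h5 : Real.pi⁻¹ ≤ 2 / Real.pi * (ω * t) := by
    rw [div_mul_eq_mul_div, inv_eq_one_div]
    gcongr
    linarith
  calc Real.pi⁻¹ ≤ (wave t ω - 1).im := by linarith
    _ ≤ ‖wave t ω - 1‖ := (le_abs_self _).trans (Complex.abs_im_le_norm _)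

end Wave

/-! ### Spectral isometry, and regularity from spectral moments -/

section SpectralCurve

open Filter

variable {H : Type*} [NormedAddCommGroup H] [InnerProductSpace ℝ H]

/-- `S` is a spectral density of the curve `X`: `⟪X s, X t⟫ = ∫ exp(iω(s - t)) S(ω) dω`. -/
structure HasSpectralDensity (X : ℝ → H) (S : ℝ → ℝ) : Prop where
  nonneg : ∀ ω, 0 ≤ S ω
  integrable : Integrable S
  inner_eq : ∀ s t, ((inner ℝ (X s) (X t) : ℝ) : ℂ) = ∫ ω, wave (s - t) ω * (S ω : ℂ)

/-- The curve together with its spectral image `t ↦ exp(iωt)`. -/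
def spectralGraph (X : ℝ → H) (t : ℝ) : H × (ℝ → ℂ) := (X t, wave t)

/-- Finite linear combinations of the curve together with their spectral images. -/
def spectralSpan (X : ℝ → H) : Submodule ℝ (H × (ℝ → ℂ)) :=
  Submodule.span ℝ (Set.range (spectralGraph X))

variable {X : ℝ → H} {S : ℝ → ℝ}

lemma spectralGraph_mem (X : ℝ → H) (t : ℝ) : spectralGraph X t ∈ spectralSpan X :=
  Submodule.subset_span ⟨t, rfl⟩

/-- Boundedness makes products of spectral images integrable against `S`. Working in the graph
avoids showing that an element of `H` determines its spectral image. -/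
lemma spectralSpan_snd {p : H × (ℝ → ℂ)} (hp : p ∈ spectralSpan X) :
    Continuous p.2 ∧ ∃ C, ∀ ω, ‖p.2 ω‖ ≤ C := by
  induction hp using Submodule.span_induction with
  | mem p hp =>
    obtain ⟨t, rfl⟩ := hp
    exact ⟨continuous_wave t, 1, fun ω => (norm_wave t ω).le⟩
  | zero => exact ⟨continuous_zero, 0, fun ω => by simp⟩
  | add p q _ _ hp hq =>
    obtain ⟨hp, C, hC⟩ := hp
    obtain ⟨hq, D, hD⟩ := hq
    exact ⟨hp.add hq, C + D, fun ω => (norm_add_le _ _).trans (add_le_add (hC ω) (hD ω))⟩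
  | smul r p _ hp =>
    obtain ⟨hp, C, hC⟩ := hp
    refine ⟨hp.const_smul r, ‖r‖ * C, fun ω => ?_⟩
    change ‖r • p.2 ω‖ ≤ _
    rw [norm_smul]
    exact mul_le_mul_of_nonneg_left (hC ω) (norm_nonneg _)

namespace HasSpectralDensity

lemma integrable_mul (hX : HasSpectralDensity X S) {p q : H × (ℝ → ℂ)}
    (hp : p ∈ spectralSpan X) (hq : q ∈ spectralSpan X) :
    Integrable fun ω => p.2 ω * (starRingEnd ℂ) (q.2 ω) * (S ω : ℂ) := by
  obtain ⟨hp, C, hC⟩ := spectralSpan_snd hp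
  obtain ⟨hq, D, hD⟩ := spectralSpan_snd hq
  refine hX.integrable.ofReal.bdd_mul (c := C * D)
    (hp.mul (Complex.continuous_conj.comp hq)).aestronglyMeasurable
    (Eventually.of_forall fun ω => ?_)
  rw [norm_mul, RCLike.norm_conj]
  exact mul_le_mul (hC ω) (hD ω) (norm_nonneg _) ((norm_nonneg _).trans (hC ω))

/-- The spectral isometry. -/
lemma inner_eq_integral (hX : HasSpectralDensity X S) {p q : H × (ℝ → ℂ)}
    (hp : p ∈ spectralSpan X) (hq : q ∈ spectralSpan X) :
    ((inner ℝ p.1 q.1 : ℝ) : ℂ) = ∫ ω, p.2 ω * (starRingEnd ℂ) (q.2 ω) * (S ω : ℂ) := by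
  induction hp, hq using Submodule.span_induction₂ with
  | mem_mem p q hp hq =>
    obtain ⟨s, rfl⟩ := hp
    obtain ⟨t, rfl⟩ := hq
    simp_rw [spectralGraph, hX.inner_eq, wave_mul_conj_wave]
  | zero_left q hq => simp
  | zero_right p hp => simp
  | add_left p q r hp hq hr h1 h2 =>
    rw [Prod.fst_add, inner_add_left, Complex.ofReal_add, h1, h2,
      ← integral_add (hX.integrable_mul hp hr) (hX.integrable_mul hq hr)]
    congr 1 with ω
    rw [Prod.snd_add, Pi.add_apply]
    ring
  | add_right p q r hp hq hr h1 h2 =>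
    rw [Prod.fst_add, inner_add_right, Complex.ofReal_add, h1, h2,
      ← integral_add (hX.integrable_mul hp hq) (hX.integrable_mul hp hr)]
    congr 1 with ω
    rw [Prod.snd_add, Pi.add_apply, map_add]
    ring
  | smul_left r p q hp hq h =>
    rw [Prod.smul_fst, inner_smul_left, Complex.ofReal_mul, h, ← integral_const_mul]
    congr 1 with ω
    rw [Prod.smul_snd, Pi.smul_apply, Complex.real_smul]
    simp only [conj_trivial]
    ring
  | smul_right r p q hp hq h =>
    rw [Prod.smul_fst, inner_smul_right, Complex.ofReal_mul, h, ← integral_const_mul]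
    congr 1 with ω
    rw [Prod.smul_snd, Pi.smul_apply, Complex.real_smul, map_mul, Complex.conj_ofReal]
    ring

lemma norm_sq_eq_integral (hX : HasSpectralDensity X S) {p : H × (ℝ → ℂ)}
    (hp : p ∈ spectralSpan X) :
    Integrable (fun ω => ‖p.2 ω‖ ^ 2 * S ω) ∧ ‖p.1‖ ^ 2 = ∫ ω, ‖p.2 ω‖ ^ 2 * S ω := by
  have h1 := hX.integrable_mul hp hp
  have h2 := hX.inner_eq_integral hp hp
  have h3 : ∀ ω, p.2 ω * (starRingEnd ℂ) (p.2 ω) * (S ω : ℂ) =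
      ((‖p.2 ω‖ ^ 2 * S ω : ℝ) : ℂ) := fun ω => by
    rw [Complex.mul_conj, Complex.normSq_eq_norm_sq, Complex.ofReal_mul]
  simp_rw [h3] at h1 h2
  rw [integral_complex_ofReal, Complex.ofReal_inj, real_inner_self_eq_norm_sq] at h2
  exact ⟨by simpa only [RCLike.re_eq_complex_re, Complex.ofReal_re] using h1.re, h2⟩

/-- Dominated convergence carried through the isometry: pointwise limits of spectral images under a
common `L²(S dω)` bound control inner products in `H`. -/
lemma tendsto_inner (hX : HasSpectralDensity X S) {ι : Type*} {l : Filter ι}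
    [l.IsCountablyGenerated] {p q : ι → H × (ℝ → ℂ)} (hp : ∀ i, p i ∈ spectralSpan X)
    (hq : ∀ i, q i ∈ spectralSpan X) {f g : ℝ → ℂ} {B : ℝ → ℝ}
    (hpf : ∀ ω, Tendsto (fun i => (p i).2 ω) l (𝓝 (f ω)))
    (hqg : ∀ ω, Tendsto (fun i => (q i).2 ω) l (𝓝 (g ω)))
    (hpB : ∀ i ω, ‖(p i).2 ω‖ ≤ B ω) (hqB : ∀ i ω, ‖(q i).2 ω‖ ≤ B ω)
    (hB : Integrable fun ω => B ω ^ 2 * S ω) :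
    Tendsto (fun i => ((inner ℝ (p i).1 (q i).1 : ℝ) : ℂ)) l
      (𝓝 (∫ ω, f ω * (starRingEnd ℂ) (g ω) * (S ω : ℂ))) := by
  simp_rw [fun i => hX.inner_eq_integral (hp i) (hq i)]
  refine tendsto_integral_filter_of_dominated_convergence _
    (Eventually.of_forall fun i => (hX.integrable_mul (hp i) (hq i)).aestronglyMeasurable)
    (Eventually.of_forall fun i => Eventually.of_forall fun ω => ?_) hB
    (Eventually.of_forall fun ω => ?_)
  · rw [norm_mul, norm_mul, RCLike.norm_conj, Complex.norm_real,
      Real.norm_of_nonneg (hX.nonneg ω), sq]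
    exact mul_le_mul_of_nonneg_right (mul_le_mul (hpB i ω) (hqB i ω) (norm_nonneg _)
      ((norm_nonneg _).trans (hpB i ω))) (hX.nonneg ω)
  · exact ((hpf ω).mul ((Complex.continuous_conj.tendsto _).comp (hqg ω))).mul_const _

lemma tendsto_zero (hX : HasSpectralDensity X S) {ι : Type*} {l : Filter ι}
    [l.IsCountablyGenerated] {p : ι → H × (ℝ → ℂ)} (hp : ∀ i, p i ∈ spectralSpan X) {B : ℝ → ℝ}
    (hpf : ∀ ω, Tendsto (fun i => (p i).2 ω) l (𝓝 0))
    (hpB : ∀ i ω, ‖(p i).2 ω‖ ≤ B ω) (hB : Integrable fun ω => B ω ^ 2 * S ω) :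
    Tendsto (fun i => (p i).1) l (𝓝 0) := by
  have h := hX.tendsto_inner hp hp (f := 0) (g := 0) hpf hpf hpB hpB hB
  simp only [Pi.zero_apply, zero_mul, integral_zero] at h
  have h2 : Tendsto (fun i => ‖(p i).1‖ ^ 2) l (𝓝 0) := by
    have h3 := (Complex.continuous_re.tendsto _).comp h
    simpa only [Function.comp_def, real_inner_self_eq_norm_sq, Complex.ofReal_re,
      Complex.zero_re] using h3
  have h4 := h2.sqrt
  simp only [Real.sqrt_sq (norm_nonneg _), Real.sqrt_zero] at h4
  exact tendsto_zero_iff_norm_tendsto_zero.2 h4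

lemma continuous_curve (hX : HasSpectralDensity X S) : Continuous X := by
  rw [continuous_iff_continuousAt]
  intro t
  rw [ContinuousAt, tendsto_iff_norm_sub_tendsto_zero, ← tendsto_zero_iff_norm_tendsto_zero]
  refine hX.tendsto_zero (p := fun s => spectralGraph X s - spectralGraph X t) (B := fun _ => 2)
    (fun s => sub_mem (spectralGraph_mem X s) (spectralGraph_mem X t)) (fun ω => ?_)
    (fun s ω => norm_wave_sub_wave_le_two s t ω) (hX.integrable.const_mul _)
  have h := (hasDerivAt_wave t ω).continuousAt.tendsto.sub_const (wave t ω)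
  rwa [sub_self] at h

/-- By the isometry `‖X s - X t‖²` is the integral of `|exp(iωs) - exp(iωt)|²` against `S`, and the
interpolated bound brings in the moment of order `2θ`. -/
lemma exists_holderWith (hX : HasSpectralDensity X S) {θ : ℝ} (h0 : 0 ≤ θ) (h1 : θ ≤ 1)
    (hint : Integrable fun ω => |ω| ^ (2 * θ) * S ω) :
    ∃ C : ℝ≥0, HolderWith C θ.toNNReal X := by
  set K := ∫ ω, |ω| ^ (2 * θ) * S ω with hK
  have hK0 : 0 ≤ K := integral_nonneg fun ω =>
    mul_nonneg (Real.rpow_nonneg (abs_nonneg _) _) (hX.nonneg ω)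
  have key : ∀ s t, dist (X s) (X t) ≤ 2 * Real.sqrt K * dist s t ^ θ := fun s t => by
    obtain ⟨hi, he⟩ := hX.norm_sq_eq_integral
      (sub_mem (spectralGraph_mem X s) (spectralGraph_mem X t))
    have h2 : ‖X s - X t‖ ^ 2 ≤ (2 * Real.sqrt K * dist s t ^ θ) ^ 2 := by
      rw [mul_pow, mul_pow, Real.sq_sqrt hK0, hK, ← integral_const_mul, ← integral_mul_const]
      refine he.trans_le (integral_mono hi ((hint.const_mul _).mul_const _) fun ω => ?_)
      have h3 := norm_wave_sub_wave_le_rpow h0 h1 s t ω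
      have h4 : ‖(spectralGraph X s - spectralGraph X t).2 ω‖ ^ 2 ≤
          (2 * (|ω| ^ θ * |s - t| ^ θ)) ^ 2 := by
        gcongr
        exact h3
      have h5 : |ω| ^ (2 * θ) = (|ω| ^ θ) ^ 2 := by
        rw [← Real.rpow_natCast, ← Real.rpow_mul (abs_nonneg _), mul_comm]
        norm_num
      calc _ ≤ (2 * (|ω| ^ θ * |s - t| ^ θ)) ^ 2 * S ω :=
            mul_le_mul_of_nonneg_right h4 (hX.nonneg ω)
        _ = _ := by
            simp only [h5, Real.dist_eq]
            ring
    rw [dist_eq_norm]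
    exact (pow_le_pow_iff_left₀ (norm_nonneg _) (by positivity) two_ne_zero).1 h2
  refine ⟨(2 * Real.sqrt K).toNNReal, fun s t => ?_⟩
  rw [edist_dist, edist_dist, Real.coe_toNNReal θ h0,
    ENNReal.ofReal_rpow_of_nonneg dist_nonneg h0]
  change _ ≤ ENNReal.ofReal (2 * Real.sqrt K) * _
  rw [← ENNReal.ofReal_mul (by positivity)]
  exact ENNReal.ofReal_le_ofReal (key s t)

/-- The difference quotient of the curve, together with its spectral image. -/
def spectralSlope (X : ℝ → H) (t h : ℝ) : H × (ℝ → ℂ) :=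
  h⁻¹ • (spectralGraph X (t + h) - spectralGraph X t)

lemma spectralSlope_mem (X : ℝ → H) (t h : ℝ) : spectralSlope X t h ∈ spectralSpan X :=
  Submodule.smul_mem _ _ (sub_mem (spectralGraph_mem X _) (spectralGraph_mem X _))

lemma spectralSlope_snd (X : ℝ → H) (t h ω : ℝ) :
    (spectralSlope X t h).2 ω = h⁻¹ • (wave (t + h) ω - wave t ω) := rfl

lemma tendsto_spectralSlope_snd (X : ℝ → H) (t ω : ℝ) :
    Tendsto (fun h => (spectralSlope X t h).2 ω) (𝓝[≠] 0) (𝓝 (Complex.I * ω * wave t ω)) := by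
  simp_rw [spectralSlope_snd]
  have h := (hasDerivAt_iff_tendsto_slope_zero (f := fun t => wave t ω)).1 (hasDerivAt_wave t ω)
  exact h

lemma norm_spectralSlope_snd_le (X : ℝ → H) (t h ω : ℝ) :
    ‖(spectralSlope X t h).2 ω‖ ≤ |ω| := by
  rw [spectralSlope_snd]
  have h1 := norm_wave_sub_wave_le (t + h) t ω
  rw [add_sub_cancel_left] at h1
  rw [norm_smul, norm_inv, Real.norm_eq_abs]
  rcases eq_or_ne h 0 with rfl | hh
  · simp
  · rw [inv_mul_le_iff₀ (abs_pos.2 hh), mul_comm]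
    exact h1

/-- Difference quotients have spectral images converging pointwise to `iω exp(iωt)` and bounded by
`|ω|`; they are therefore Cauchy, and completeness supplies the derivative. -/
lemma exists_hasDerivAt [CompleteSpace H] (hX : HasSpectralDensity X S)
    (hint : Integrable fun ω => ω ^ 2 * S ω) (t : ℝ) : ∃ y, HasDerivAt X y t := by
  have hc : Cauchy (map (fun h => (spectralSlope X t h).1) (𝓝[≠] (0 : ℝ))) := by
    rw [cauchy_map_iff', tendsto_uniformity_iff_dist_tendsto_zero]
    simp_rw [dist_eq_norm]
    rw [← tendsto_zero_iff_norm_tendsto_zero]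
    refine hX.tendsto_zero (p := fun i : ℝ × ℝ => spectralSlope X t i.1 - spectralSlope X t i.2)
      (B := fun ω => 2 * |ω|)
      (fun i => sub_mem (spectralSlope_mem X t _) (spectralSlope_mem X t _)) (fun ω => ?_)
      (fun i ω => ?_) ?_
    · have h1 := ((tendsto_spectralSlope_snd X t ω).comp tendsto_fst).sub
        ((tendsto_spectralSlope_snd X t ω).comp (tendsto_snd (f := 𝓝[≠] (0 : ℝ))))
      rw [sub_self] at h1
      exact h1
    · refine (norm_sub_le _ _).trans ?_
      rw [two_mul]
      exact add_le_add (norm_spectralSlope_snd_le X t _ ω) (norm_spectralSlope_snd_le X t _ ω)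
    · simp_rw [mul_pow, sq_abs, mul_assoc]
      exact hint.const_mul _
  obtain ⟨y, hy⟩ := CompleteSpace.complete hc
  exact ⟨y, hasDerivAt_iff_tendsto_slope_zero.2 hy⟩

/-- The image `iω exp(iωt)` of the derivative contributes `ω²` to the density, so the result can be
iterated. -/
lemma deriv_curve [CompleteSpace H] (hX : HasSpectralDensity X S)
    (hint : Integrable fun ω => ω ^ 2 * S ω) :
    Differentiable ℝ X ∧ HasSpectralDensity (deriv X) (fun ω => ω ^ 2 * S ω) := by
  have hd : Differentiable ℝ X := fun t =>
    let ⟨_, hy⟩ := hX.exists_hasDerivAt hint t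
    hy.differentiableAt
  refine ⟨hd, fun ω => mul_nonneg (sq_nonneg _) (hX.nonneg ω), hint, fun s t => ?_⟩
  have h1 : Tendsto (fun h => ((inner ℝ (spectralSlope X s h).1 (spectralSlope X t h).1 : ℝ) : ℂ))
      (𝓝[≠] 0) (𝓝 ((inner ℝ (deriv X s) (deriv X t) : ℝ) : ℂ)) :=
    (Complex.continuous_ofReal.tendsto _).comp
      ((hasDerivAt_iff_tendsto_slope_zero.1 (hd s).hasDerivAt).inner
        (hasDerivAt_iff_tendsto_slope_zero.1 (hd t).hasDerivAt))
  have h2 := hX.tendsto_inner (spectralSlope_mem X s) (spectralSlope_mem X t)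
    (tendsto_spectralSlope_snd X s) (tendsto_spectralSlope_snd X t)
    (norm_spectralSlope_snd_le X s) (norm_spectralSlope_snd_le X t)
    (by simpa only [sq_abs] using hint)
  rw [tendsto_nhds_unique h1 h2]
  congr 1 with ω
  rw [← wave_mul_conj_wave, map_mul, map_mul, Complex.conj_I, Complex.conj_ofReal]
  push_cast
  linear_combination (-(ω : ℂ) ^ 2 * wave s ω * (starRingEnd ℂ) (wave t ω) * S ω) * Complex.I_sq

/-- A curve whose spectral density has a finite moment of order `2(n + θ)` is `n` times continuously
differentiable, and its derivative of order `n` is Hölder continuous with exponent `θ`. -/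
theorem contDiff_and_holderWith [CompleteSpace H] (hX : HasSpectralDensity X S) (n : ℕ) {θ : ℝ}
    (h0 : 0 ≤ θ) (h1 : θ ≤ 1) (hint : Integrable fun ω => |ω| ^ (2 * (n + θ)) * S ω) :
    ContDiff ℝ n X ∧ ∃ C : ℝ≥0, HolderWith C θ.toNNReal (iteratedDeriv n X) := by
  induction n generalizing X S with
  | zero =>
    refine ⟨contDiff_zero.2 hX.continuous_curve, ?_⟩
    rw [iteratedDeriv_zero]
    exact hX.exists_holderWith h0 h1 (by simpa using hint)
  | succ n ih =>
    -- The second moment is controlled by the zeroth and the top one, since `ω² ≤ 1 + |ω| ^ (2 (n +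
    -- 1 + θ))`.
    have hint2 : Integrable fun ω => ω ^ 2 * S ω := by
      refine Integrable.mono' (hX.integrable.add hint)
        ((continuous_pow 2).aestronglyMeasurable.mul hX.integrable.aestronglyMeasurable)
        (Eventually.of_forall fun ω => ?_)
      rw [Real.norm_of_nonneg (mul_nonneg (sq_nonneg _) (hX.nonneg ω)), Pi.add_apply,
        ← one_add_mul]
      refine mul_le_mul_of_nonneg_right ?_ (hX.nonneg ω)
      rw [← sq_abs]
      rcases le_total |ω| 1 with h | h
      · have h2 : |ω| ^ 2 ≤ 1 := pow_le_one₀ (abs_nonneg _) h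
        have h3 : 0 ≤ |ω| ^ (2 * (((n + 1 : ℕ) : ℝ) + θ)) := by positivity
        linarith
      · have h2 : |ω| ^ 2 ≤ |ω| ^ (2 * (((n + 1 : ℕ) : ℝ) + θ)) := by
          rw [← Real.rpow_natCast]
          refine Real.rpow_le_rpow_of_exponent_le h ?_
          push_cast
          have : (0 : ℝ) ≤ n := n.cast_nonneg
          linarith
        linarith
    obtain ⟨hd, hX'⟩ := hX.deriv_curve hint2
    obtain ⟨hc, C, hC⟩ := ih hX' (hint.congr (Eventually.of_forall fun ω => by
      -- The addition law for real powers needs a positive base; at 0 both sides vanish.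
      rcases eq_or_ne ω 0 with rfl | hω
      · have h2 : (2 * (((n + 1 : ℕ) : ℝ) + θ)) ≠ 0 := by positivity
        simp only [abs_zero, Real.zero_rpow h2]
        simp
      · simp only
        rw [show 2 * (((n + 1 : ℕ) : ℝ) + θ) = 2 * (n + θ) + (2 : ℕ) by push_cast; ring,
          Real.rpow_add (abs_pos.2 hω), Real.rpow_natCast, sq_abs]
        ring))
    refine ⟨?_, C, by rwa [iteratedDeriv_succ']⟩
    push_cast
    exact contDiff_succ_iff_deriv.2 ⟨hd, by simp, hc⟩

end HasSpectralDensity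

end SpectralCurve

/-! ### Limits to the smoothness of a curve -/

section ForwardDifference

open Filter

variable {H : Type*} [NormedAddCommGroup H] [NormedSpace ℝ H]

lemma hasDerivAt_fwdDiff_iter {f : ℝ → H} (hf : Differentiable ℝ f) (h : ℝ) (k : ℕ) (t : ℝ) :
    HasDerivAt ((fwdDiff h)^[k] f) ((fwdDiff h)^[k] (deriv f) t) t := by
  induction k generalizing t with
  | zero => exact (hf t).hasDerivAt
  | succ k ih =>
    rw [Function.iterate_succ_apply', Function.iterate_succ_apply']
    exact (ih (t + h)).comp_add_const t h |>.sub (ih t)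

/-- The forward difference of order `n + 1` of a curve whose derivative of order `n` is Hölder
continuous with exponent `θ` is `O(h ^ (n + θ))`. -/
lemma norm_fwdDiff_iter_le {f : ℝ → H} {n : ℕ} (hf : ContDiff ℝ n f) {a b C θ : ℝ}
    (hC : ∀ x ∈ Set.Icc a b, ∀ y ∈ Set.Icc a b,
      ‖iteratedDeriv n f x - iteratedDeriv n f y‖ ≤ C * |x - y| ^ θ)
    {h t : ℝ} (hh : 0 ≤ h) (hat : a ≤ t) (htb : t + (n + 1) * h ≤ b) :
    ‖(fwdDiff h)^[n + 1] f t‖ ≤ C * h ^ θ * h ^ n := by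
  induction n generalizing f t with
  | zero =>
    have h1 := hC (t + h) ⟨by linarith, by simpa using htb⟩ t ⟨hat, by
      push_cast at htb
      linarith⟩
    simpa [fwdDiff, abs_of_nonneg hh] using h1
  | succ n ih =>
    push_cast at hf htb
    obtain ⟨hd, -, hf'⟩ := contDiff_succ_iff_deriv.1 hf
    rw [Function.iterate_succ_apply', fwdDiff]
    have hn : 0 ≤ (n + 1) * h := by positivity
    -- Differencing commutes with differentiation, so each mean value inequality trades one
    -- derivative for a factor `h`.
    have h1 := norm_image_sub_le_of_norm_deriv_le_segment' (a := t) (b := t + h)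
      (f := (fwdDiff h)^[n + 1] f) (f' := (fwdDiff h)^[n + 1] (deriv f)) (C := C * h ^ θ * h ^ n)
      (fun x _ => (hasDerivAt_fwdDiff_iter hd h (n + 1) x).hasDerivWithinAt)
      (fun x hx => ih hf' (by simpa only [iteratedDeriv_succ'] using hC)
        (hat.trans hx.1) (by linarith [hx.2])) (t + h) ⟨by linarith, le_rfl⟩
    refine h1.trans_eq ?_
    ring

end ForwardDifference

/-! ### Lower bounds for forward differences -/

section SmoothnessBound

open Filter

variable {H : Type*} [NormedAddCommGroup H] [InnerProductSpace ℝ H] {X : ℝ → H} {S : ℝ → ℝ}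

lemma fwdDiff_iter_spectralGraph (X : ℝ → H) (h : ℝ) (k : ℕ) (t : ℝ) :
    (fwdDiff h)^[k] (spectralGraph X) t ∈ spectralSpan X ∧
      ((fwdDiff h)^[k] (spectralGraph X) t).1 = (fwdDiff h)^[k] X t ∧
      ∀ ω, ((fwdDiff h)^[k] (spectralGraph X) t).2 ω = wave t ω * (wave h ω - 1) ^ k := by
  induction k generalizing t with
  | zero => exact ⟨spectralGraph_mem X t, rfl, fun ω => by simp [spectralGraph]⟩
  | succ k ih =>
    obtain ⟨h1, h2, h3⟩ := ih (t + h)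
    obtain ⟨h4, h5, h6⟩ := ih t
    simp only [Function.iterate_succ_apply']
    refine ⟨sub_mem h1 h4, ?_, fun ω => ?_⟩
    · rw [fwdDiff, fwdDiff, Prod.fst_sub, h2, h5]
    · rw [fwdDiff, Prod.snd_sub, Pi.sub_apply, h3, h6, wave_add]
      ring

/-- Keep only the band `[1/(2h), 1/h]`, where the multiplier `|exp(iωh) - 1|` is at least `1/π`. Its
length `1/(2h)` accounts for the exponent `2m - 1`, and `h * (2 * ω₀) ≤ 1` places it beyond `ω₀`. -/
lemma HasSpectralDensity.le_norm_fwdDiff_sq (hX : HasSpectralDensity X S) {m c ω₀ : ℝ}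
    (hc : 0 ≤ c) (hm : 0 ≤ m) (hS : ∀ ω, ω₀ ≤ ω → 0 < ω → c * ω ^ (-(2 * m)) ≤ S ω) (k : ℕ) {h : ℝ}
    (hh : 0 < h) (hω₀ : h * (2 * ω₀) ≤ 1) :
    (Real.pi⁻¹ ^ k) ^ 2 * c / 2 * h ^ (2 * m - 1) ≤ ‖(fwdDiff h)^[k] X 0‖ ^ 2 := by
  obtain ⟨h1, h2, h3⟩ := fwdDiff_iter_spectralGraph X h k 0
  obtain ⟨hi, he⟩ := hX.norm_sq_eq_integral h1
  rw [← h2, he]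
  have hI : ∀ ω ∈ Set.Icc ((2 * h)⁻¹) h⁻¹, (Real.pi⁻¹ ^ k) ^ 2 * c * h ^ (2 * m) ≤
      ‖((fwdDiff h)^[k] (spectralGraph X) 0).2 ω‖ ^ 2 * S ω := by
    intro ω hω
    have hω0 : 0 < ω := lt_of_lt_of_le (by positivity) hω.1
    have h4 : 1 / 2 ≤ ω * h := by
      have := mul_le_mul_of_nonneg_right hω.1 hh.le
      have h5 : (2 * h)⁻¹ * h = 1 / 2 := by field_simp
      linarith
    have h5 : ω * h ≤ 1 := by
      have := mul_le_mul_of_nonneg_right hω.2 hh.le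
      rwa [inv_mul_cancel₀ hh.ne'] at this
    have h6 : ω₀ ≤ ω := by
      refine le_trans ?_ hω.1
      rw [inv_eq_one_div, le_div_iff₀ (by positivity)]
      linarith
    have h7 : h ^ (2 * m) ≤ ω ^ (-(2 * m)) := by
      rw [Real.rpow_neg hω0.le, ← Real.inv_rpow hω0.le]
      refine Real.rpow_le_rpow hh.le ?_ (by positivity)
      rw [inv_eq_one_div, le_div_iff₀ hω0]
      linarith
    rw [h3, wave_zero, one_mul, norm_pow, mul_assoc]
    refine mul_le_mul ?_ ((mul_le_mul_of_nonneg_left h7 hc).trans (hS ω h6 hω0)) (by positivity)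
      (by positivity)
    gcongr
    exact inv_pi_le_norm_wave_sub_one h4 h5
  calc (Real.pi⁻¹ ^ k) ^ 2 * c / 2 * h ^ (2 * m - 1)
      = ∫ _ in Set.Icc ((2 * h)⁻¹) h⁻¹, (Real.pi⁻¹ ^ k) ^ 2 * c * h ^ (2 * m) := by
        rw [setIntegral_const, Real.volume_real_Icc_of_le, smul_eq_mul,
          Real.rpow_sub hh, Real.rpow_one]
        · field_simp
          ring
        · gcongr
          linarith
    _ ≤ ∫ ω in Set.Icc ((2 * h)⁻¹) h⁻¹, ‖((fwdDiff h)^[k] (spectralGraph X) 0).2 ω‖ ^ 2 * S ω :=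
        setIntegral_mono_on (continuousOn_const.integrableOn_compact isCompact_Icc) hi.integrableOn
          measurableSet_Icc hI
    _ ≤ _ := setIntegral_le_integral hi (Eventually.of_forall fun ω =>
        mul_nonneg (sq_nonneg _) (hX.nonneg ω))

/-- A curve whose spectral density decays no faster than `ω ^ (-2m)` has smoothness at most
`m - 1 / 2`. -/
theorem HasSpectralDensity.add_le_of_holderOnWith (hX : HasSpectralDensity X S) {m c ω₀ θ : ℝ}
    (hc : 0 < c) (hm : 0 ≤ m) (hS : ∀ ω, ω₀ ≤ ω → 0 < ω → c * ω ^ (-(2 * m)) ≤ S ω) {n : ℕ}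
    (hθ : 0 ≤ θ) (hcd : ContDiff ℝ n X) {C : ℝ≥0} {N : Set ℝ} (hN : N ∈ 𝓝 (0 : ℝ))
    (hH : HolderOnWith C θ.toNNReal (iteratedDeriv n X) N) : n + θ ≤ m - 1 / 2 := by
  by_contra! hlt
  obtain ⟨r, hr, hball⟩ := Metric.nhds_basis_closedBall.mem_iff.1 hN
  rw [Real.closedBall_eq_Icc, zero_sub, zero_add] at hball
  set K := (Real.pi⁻¹ ^ (n + 1)) ^ 2 * c / 2 with hK
  have hK0 : 0 < K := by positivity
  -- Comparing the lower and upper bounds for the difference of order `n + 1` leaves a positive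
  -- constant below a positive power of `h`, which is impossible as `h` tends to 0.
  have key : ∀ᶠ h in 𝓝[>] (0 : ℝ), K ≤ C ^ 2 * h ^ (2 * (n + θ) - (2 * m - 1)) := by
    have e1 : ∀ᶠ h in 𝓝[>] (0 : ℝ), h * (2 * ω₀) ≤ 1 := by
      have : Tendsto (fun h : ℝ => h * (2 * ω₀)) (𝓝[>] 0) (𝓝 0) := by
        have h1 : Continuous fun h : ℝ => h * (2 * ω₀) := by fun_prop
        simpa using (h1.tendsto 0).mono_left nhdsWithin_le_nhds
      exact this.eventually_le_const one_pos
    have e2 : ∀ᶠ h in 𝓝[>] (0 : ℝ), 0 + (n + 1) * h ≤ r := by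
      have : Tendsto (fun h : ℝ => 0 + (n + 1) * h) (𝓝[>] 0) (𝓝 0) := by
        have h1 : Continuous fun h : ℝ => 0 + (n + 1) * h := by fun_prop
        simpa using (h1.tendsto 0).mono_left nhdsWithin_le_nhds
      exact this.eventually_le_const hr
    filter_upwards [e1, e2, self_mem_nhdsWithin] with h h1 h2 hh
    rw [Set.mem_Ioi] at hh
    have h3 := hX.le_norm_fwdDiff_sq hc.le hm hS (n + 1) hh h1
    have h4 := norm_fwdDiff_iter_le hcd (a := -r) (b := r) (C := C) (θ := θ)
      (fun x hx y hy => by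
        have := hH.dist_le (hball hx) (hball hy)
        rwa [dist_eq_norm, Real.dist_eq, Real.coe_toNNReal θ hθ] at this)
      hh.le (t := 0) (by linarith) h2
    have h5 : K * h ^ (2 * m - 1) ≤ (C * h ^ θ * h ^ n) ^ 2 :=
      h3.trans (pow_le_pow_left₀ (norm_nonneg _) h4 2)
    have h6 : (C * h ^ θ * h ^ n : ℝ) ^ 2 = C ^ 2 * h ^ (2 * (n + θ)) := by
      rw [mul_assoc, mul_pow, ← Real.rpow_natCast h n, ← Real.rpow_add hh,
        ← Real.rpow_natCast (h ^ (θ + n)), ← Real.rpow_mul hh.le]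
      push_cast
      ring_nf
    rw [h6] at h5
    rw [Real.rpow_sub hh, mul_div_assoc', le_div_iff₀ (by positivity)]
    exact h5
  have hexp : 0 < 2 * (n + θ) - (2 * m - 1) := by linarith
  have hlim : Tendsto (fun h : ℝ => (C : ℝ) ^ 2 * h ^ (2 * (n + θ) - (2 * m - 1))) (𝓝[>] 0)
      (𝓝 0) := by
    have h1 : Continuous fun h : ℝ => (C : ℝ) ^ 2 * h ^ (2 * (n + θ) - (2 * m - 1)) :=
      continuous_const.mul (Real.continuous_rpow_const hexp.le)
    have h2 := (h1.tendsto 0).mono_left (nhdsWithin_le_nhds (s := Set.Ioi 0))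
    rwa [Real.zero_rpow hexp.ne', mul_zero] at h2
  exact absurd (ge_of_tendsto hlim key) (not_le.2 hK0)

end SmoothnessBound

/-! ### Decay of the marginal temporal spectrum -/

section Decay

open Filter

variable {a b κ C₀ : ℝ} {S : ℝ → ℝ}

lemma exists_le_spectrum (ha : 0 ≤ a) (hb : 0 < b) (hκ : 0 < κ) (hC : 0 < C₀)
    (hS : ∀ ω, S ω = C₀ * negEulerIntegral a b (κ * ω ^ 2)) :
    ∃ c ω₀ : ℝ, 0 < c ∧ ∀ ω, ω₀ ≤ ω → 0 < ω → c * ω ^ (-(2 * min a b)) ≤ S ω := by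
  -- The threshold `κ^(-1/2)` ensures `κ ω² ≥ 1`, as the lower bound for Euler's integral demands.
  refine ⟨C₀ * (2 ^ (-a) * b⁻¹ * κ ^ (-min a b)), Real.sqrt κ⁻¹, by positivity, fun ω h1 h2 => ?_⟩
  have h3 : 1 ≤ κ * ω ^ 2 := by
    have h4 := Real.sqrt_le_left h2.le |>.1 h1
    have h5 := mul_le_mul_of_nonneg_left h4 hκ.le
    rwa [mul_inv_cancel₀ hκ.ne'] at h5
  rw [hS, mul_assoc]
  refine mul_le_mul_of_nonneg_left ?_ hC.le
  refine le_trans (le_of_eq ?_) (rpow_neg_min_le_negEulerIntegral ha hb h3)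
  rw [Real.mul_rpow hκ.le (by positivity), ← Real.rpow_natCast, ← Real.rpow_mul h2.le]
  push_cast
  ring_nf

/-- An integrable spectrum cannot dominate a tail `ω ^ (-r)` with `r ≤ 1`. This forces the
smoothness to be nonnegative. -/
lemma half_lt_min_of_integrable (ha : 0 ≤ a) (hb : 0 < b) (hκ : 0 < κ) (hC : 0 < C₀)
    (hS : ∀ ω, S ω = C₀ * negEulerIntegral a b (κ * ω ^ 2)) (hint : Integrable S) :
    1 / 2 < min a b := by
  obtain ⟨c, ω₀, hc, hle⟩ := exists_le_spectrum ha hb hκ hC hS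
  have hpos : 0 < max ω₀ 1 := lt_max_of_lt_right one_pos
  have h1 : IntegrableOn (fun ω : ℝ => c * ω ^ (-(2 * min a b))) (Set.Ioi (max ω₀ 1)) := by
    refine Integrable.mono' hint.integrableOn
      (Measurable.aestronglyMeasurable (by fun_prop)) ?_
    filter_upwards [ae_restrict_mem measurableSet_Ioi] with ω hω
    have hω0 : 0 < ω := hpos.trans hω
    rw [Real.norm_of_nonneg (by positivity)]
    exact hle ω ((le_max_left _ _).trans (le_of_lt hω)) hω0
  have h2 := (integrable_const_mul_iff (IsUnit.mk0 c hc.ne') _).1 h1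
  have h3 := (integrableOn_Ioi_rpow_iff hpos).1 h2
  linarith

lemma integrable_moment (hκ : 0 < κ) (hC : 0 < C₀)
    (hS : ∀ ω, S ω = C₀ * negEulerIntegral a b (κ * ω ^ 2)) (hint : Integrable S)
    (hS0 : ∀ ω, 0 ≤ S ω) {ν : ℝ} (hν : 0 ≤ ν) (hνab : ν < min a b - 1 / 2) :
    Integrable fun ω => |ω| ^ (2 * ν) * S ω := by
  -- Room is needed on both sides: `p < min a b` for the upper bound on `S`, and `p > ν + 1/2` so
  -- that `|ω| ^ (2ν - 2p)` is integrable at infinity.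
  obtain ⟨p, hp1, hp2⟩ := exists_between (show ν + 1 / 2 < min a b by linarith)
  have hpa : p ≤ a := hp2.le.trans (min_le_left _ _)
  have hpb : p < b := hp2.trans_le (min_le_right _ _)
  have hbp : 0 < b - p := by linarith
  set r := 2 * p - 2 * ν with hr
  have hr1 : 1 < r := by linarith
  have hJ : Integrable fun ω : ℝ => (1 + ‖ω‖) ^ (-r) :=
    integrable_one_add_norm (by simpa using hr1)
  -- The factor `2 ^ r` comes from `1 + |ω| ≤ 2 |ω|` on the tail `|ω| ≥ 1`; for `|ω| ≤ 1` the bound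
  -- is `S` itself.
  set D := C₀ * ((b - p)⁻¹ * κ ^ (-p)) * 2 ^ r with hD
  refine Integrable.mono' (hint.add (hJ.const_mul D)) ?_ (Eventually.of_forall fun ω => ?_)
  · exact (Measurable.aestronglyMeasurable (by fun_prop)).mul hint.aestronglyMeasurable
  have hD0 : 0 ≤ D * (1 + ‖ω‖) ^ (-r) := by positivity
  rw [Real.norm_of_nonneg (mul_nonneg (by positivity) (hS0 ω)), Pi.add_apply]
  rcases le_total |ω| 1 with h | h
  · have h1 : |ω| ^ (2 * ν) ≤ 1 := Real.rpow_le_one (abs_nonneg _) h (by linarith)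
    have h2 := mul_le_mul_of_nonneg_right h1 (hS0 ω)
    linarith
  · have hω : 0 < |ω| := by linarith
    have h1 : S ω ≤ C₀ * ((b - p)⁻¹ * κ ^ (-p)) * |ω| ^ (-(2 * p)) := by
      rw [hS, mul_assoc]
      refine mul_le_mul_of_nonneg_left ?_ hC.le
      rw [← sq_abs]
      refine (negEulerIntegral_le (by linarith) hpa hpb (by positivity)).trans_eq ?_
      rw [Real.mul_rpow hκ.le (by positivity), ← Real.rpow_natCast, ← Real.rpow_mul hω.le]
      push_cast
      ring_nf
    have h2 : |ω| ^ (-r) ≤ 2 ^ r * (1 + ‖ω‖) ^ (-r) := by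
      rw [Real.norm_eq_abs]
      have h3 : (2 * |ω|) ^ (-r) ≤ (1 + |ω|) ^ (-r) :=
        Real.rpow_le_rpow_of_nonpos (by linarith) (by linarith) (by linarith)
      rw [Real.mul_rpow zero_le_two hω.le] at h3
      have h4 := mul_le_mul_of_nonneg_left h3 (by positivity : (0 : ℝ) ≤ 2 ^ r)
      rwa [← mul_assoc, ← Real.rpow_add two_pos, add_neg_cancel, Real.rpow_zero, one_mul] at h4
    calc |ω| ^ (2 * ν) * S ω
        ≤ |ω| ^ (2 * ν) * (C₀ * ((b - p)⁻¹ * κ ^ (-p)) * |ω| ^ (-(2 * p))) := by gcongr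
      _ = C₀ * ((b - p)⁻¹ * κ ^ (-p)) * |ω| ^ (-r) := by
          rw [mul_left_comm, ← Real.rpow_add hω, hr]
          ring_nf
      _ ≤ C₀ * ((b - p)⁻¹ * κ ^ (-p)) * (2 ^ r * (1 + ‖ω‖) ^ (-r)) := by gcongr
      _ = D * (1 + ‖ω‖) ^ (-r) := by rw [hD]; ring
      _ ≤ S ω + D * (1 + ‖ω‖) ^ (-r) := le_add_of_nonneg_left (hS0 ω)

variable {Ω : Type*} [MeasurableSpace Ω] {P : Measure Ω} {X : ℝ → Ω → ℝ}

lemma IsProcessSpectrum.hasSpectralDensity (hS : IsProcessSpectrum P X S)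
    (hX : ∀ t, MemLp (X t) 2 P) (hX0 : ∀ t, ∫ w, X t w ∂P = 0) :
    HasSpectralDensity (fun t => (hX t).toLp (X t)) S := by
  refine ⟨hS.nonneg, hS.integrable, fun s t => ?_⟩
  rw [← covariance_eq_inner (hX s).coeFn_toLp.symm (hX t).coeFn_toLp.symm (hX0 s) (hX0 t),
    hS.covariance_eq]
  rfl

/-- The mean-square smoothness of a centred process whose spectral density is a multiple of
`₂F₁(a, b; b + 1; -κω²)`. -/
theorem IsProcessSpectrum.hasMSSmoothness (hP : IsProcessSpectrum P X S)
    (hX : ∀ t, MemLp (X t) 2 P) (hX0 : ∀ t, ∫ w, X t w ∂P = 0)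
    (ha : 0 ≤ a) (hb : 0 < b) (hκ : 0 < κ) (hC : 0 < C₀)
    (hS : ∀ ω, S ω = C₀ * negEulerIntegral a b (κ * ω ^ 2)) :
    HasMSSmoothness P X (min a b - 1 / 2) := by
  have hD := hP.hasSpectralDensity hX hX0
  refine ⟨?_, fun ν hν hlt => ⟨hX, ?_⟩, fun ν hlt => ?_⟩
  · linarith [half_lt_min_of_integrable ha hb hκ hC hS hP.integrable]
  · have hfloor := Nat.floor_le hν
    have hfloor' := Nat.lt_floor_add_one ν
    obtain ⟨h1, C, h2⟩ := hD.contDiff_and_holderWith ⌊ν⌋₊ (θ := ν - ⌊ν⌋₊) (by linarith)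
      (by linarith) (by
        rw [add_sub_cancel]
        exact integrable_moment hκ hC hS hP.integrable hP.nonneg hν hlt)
    exact ⟨h1, fun t => ⟨C, Set.univ, univ_mem, h2.holderOnWith _⟩⟩
  · rintro ⟨hX', h1, h2⟩
    obtain ⟨c, ω₀, hc, hle⟩ := exists_le_spectrum ha hb hκ hC hS
    obtain ⟨C, N, hN, hH⟩ := h2 0
    have hmin := half_lt_min_of_integrable ha hb hκ hC hS hP.integrable
    have hfloor := Nat.floor_le (show 0 ≤ ν by linarith)
    have := hD.add_le_of_holderOnWith hc (by linarith) hle (θ := ν - ⌊ν⌋₊) (by linarith) h1 hN hH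
    linarith

end Decay

end DEMF

end

/-! ### Assembly of the main theorem -/

theorem proposition2 {Ω : Type*} [MeasurableSpace Ω] (P : Measure Ω) [IsProbabilityMeasure P]
    (αt αs αe γt γs γe α νs : ℝ)
    (hαt : 0 ≤ αt) (hαs : 0 < αs) (hαe : 0 ≤ αe)
    (hγt : 0 < γt) (hγs : 0 < γs) (hγe : 0 < γe)
    (hα : α = αe + αs * (αt - 1 / 2)) (hα1 : 1 < α) (hνs : νs = α - 1)
    (W u : 𝓢(DEMF.SpaceTime, ℝ) → Ω → ℝ)
    (hW : DEMF.IsNoise αe γs γe P W)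
    (hu : DEMF.IsSolution αt αs γt γs P W u) :
    ∃ (St : ℝ → ℝ) (C : ℝ), 0 < C ∧
      (∀ ωt : ℝ, (St ωt : ℂ) = (C : ℂ) * DEMF.gaussHypergeometric
        (αt : ℂ) (((αe - 1) / αs + αt : ℝ) : ℂ) (((αe - 1) / αs + αt + 1 : ℝ) : ℂ)
        ((-(γt ^ 2 * γs ^ (-2 * αs) * ωt ^ 2) : ℝ) : ℂ)) ∧
      DEMF.IsMarginalTemporalSpectrum P u St ∧
      ∀ U : DEMF.Space → ℝ → Ω → ℝ, DEMF.IsPointwiseVersion P u U → ∀ s : DEMF.Space,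
        DEMF.IsProcessSpectrum P (U s) St ∧
        DEMF.HasMSSmoothness P (U s) (min (αt - 1 / 2) (νs / αs)) := by
  obtain ⟨b, hb⟩ : ∃ b, b = (αe - 1) / αs + αt := ⟨_, rfl⟩
  have hνb : νs / αs = b - 1 / 2 := by
    rw [hνs, hα, hb]
    field_simp
    ring
  -- The assumption `α > 1` means `νs > 0`, hence even `b > 1/2`.
  have hb0 : 0 < b := by
    have : 0 < νs / αs := div_pos (by linarith) hαs
    linarith
  obtain ⟨C₀, hC₀, hSt⟩ := DEMF.exists_marginalSpectrum_eq (γt := γt) hαs hγs hγe hb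
  have hS := hu.isSpectrum hαs hγs hW
  have hmean := hu.integral_eq_zero hαs hγs hW
  -- Dividing by `b` cancels the prefactor in Euler's representation of `₂F₁`.
  refine ⟨DEMF.marginalSpectrum αt αs αe γt γs γe, C₀ / b, by positivity, fun ωt => ?_,
    ⟨_, hS, fun ωt => ⟨DEMF.integrable_fieldSpectrum_slice hαt hαs hγs ωt hb hb0, rfl⟩⟩,
    fun U hU s => ?_⟩
  · rw [← hb, DEMF.gaussHypergeometric_neg_ofReal αt hb0 (by positivity), hSt,
      ← Complex.ofReal_mul]
    change _ = ((C₀ / b * (b * DEMF.negEulerIntegral _ _ _) : ℝ) : ℂ)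
    rw [← mul_assoc, div_mul_cancel₀ _ hb0.ne']
  · have hP : DEMF.IsProcessSpectrum P (U s) (DEMF.marginalSpectrum αt αs αe γt γs γe) :=
      hU.isProcessSpectrum hmean hS s
    refine ⟨hP, ?_⟩
    rw [hνb, min_sub_sub_right]
    exact hP.hasMSSmoothness (hU.memLp s)
      (fun t => hU.integral_eq_zero hmean (WithLp.toLp 2 (s, t))) hαt hb0
      (κ := γt ^ 2 * γs ^ (-2 * αs)) (by positivity) hC₀ hSt
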